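/- Setting. Let $N\ge 2$ parties, Alice and Bob$_1,\dots,$Bob$_{N-1}$, hold finite-dimensional systems with Hilbert space $\mathcal H=\bigotimes_i\mathbb C^{d_i}$. A state is a positive semidefinite operator of trace $1$ on $\mathcal H$. For a subset $S$ of the parties with $\emptyset\ne S\ne\{\text{all parties}\}$, a state is separable with respect to $S|\bar S$ if it is a finite convex combination $\sum_j q_j\,\rho_S^j\otimes\rho_{\bar S}^j$ with states $\rho^j_S$ of the parties in $S$ and $\rho^j_{\bar S}$ of the parties in $\bar S$; let $\Sigma$ be the union, over all such $S$, of the sets of states separable with respect to $S|\bar S$. A state is biseparable if it is a finite convex combination of elements of $\Sigma$. A protocol specifies for each party a finite number of local POVMs, one of which is used in the key generation rounds. For a state $\rho$ with a purification $|\psi\rangle$ on $\mathcal H\otimes\mathcal H_E$, the second factor held by Eve, the asymptotic key rate is $$r_\infty=\max\Bigl[0,\;H(X|E)-\max_i H(X|Y_i)\Bigr],$$ where $X$ and $Y_i$ are the outcomes of the key generation measurements of Alice and Bob$_i$ and $H(\cdot|\cdot)$ is the conditional von Neumann entropy (in bits). The $N$-BB84 protocol is the protocol on $N$ qubits in which every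 party measures either in the $Z$ basis (key generation) or in the $X$ basis (parameter estimation). Statement. 1. For every $N\ge2$, all local dimensions, every protocol and every state $\rho$ (with any finite-dimensional purification), if $r_\infty>0$ then $\rho$ is entangled across every bipartition: it is not separable with respect to $S|\bar S$ for any $S$, that is, $\rho\notin\Sigma$. 2. For every $N\ge2$ and all local dimensions, if $W$ is a Hermitian operator with $\mathrm{Tr}(W\sigma)\ge0$ for all $\sigma\in\Sigma$, then $\mathrm{Tr}(W\rho)\ge0$ for every biseparable state $\rho$. Thus no linear witness for the complement of $\Sigma$ detects a biseparable state. 3. For every $N\ge3$ and all local dimensions $d_i\ge2$, the set $\Sigma$ is not convex. 4. For every $N\ge3$ there is a biseparable state $\rho\notin\Sigma$ of $N$ qubits for which the $N$-BB84 protocol has $r_\infty>0$ (for every finite-dimensional purification). Moreover $\rho$ can be chosen such that $r_\infty>0$ is certified by the measurements of the protocol: every state that has the same $N$-BB84 outcome probabilities as $\rho$ has $r_\infty>0$. 5. For every $N\ge3$, the condition $r_\infty>0$ for the $N$-BB84 protocol is not a linear witness: there is no Hermitian operator $W$ on $N$ qubits such that for every state $\rho$ (and every finite-dimensional purification of it)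 $r_\infty>0$ if and only if $\mathrm{Tr}(W\rho)<0$. -/

import Mathlib

open scoped ComplexOrder Matrix

noncomputable section

namespace CKA

/-- Density matrices: positive semidefinite with unit trace. -/
def IsState {κ : Type*} [Fintype κ] (ρ : Matrix κ κ ℂ) : Prop :=
  ρ.PosSemidef ∧ ρ.trace = 1

/-- Von Neumann entropy `-Tr (ρ log₂ ρ)`, in bits. -/
def vonNeumannEntropy {κ : Type*} [Fintype κ] [DecidableEq κ] (ρ : Matrix κ κ ℂ) : ℝ :=
  (cfc Real.negMulLog ρ).trace.re / Real.log 2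

/-- Shannon entropy `-∑ p log₂ p`, in bits. -/
def shannonEntropy {κ : Type*} [Fintype κ] (p : κ → ℝ) : ℝ :=
  (∑ a, Real.negMulLog (p a)) / Real.log 2

/-- A POVM with `k` outcomes on `ℂ^D`. -/
structure POVM (D k : ℕ) where
  effect : Fin k → Matrix (Fin D) (Fin D) ℂ
  posSemidef : ∀ a, (effect a).PosSemidef
  sum_eq_one : ∑ a, effect a = 1

section System

/- There are `n + 1` parties: Alice is party `0` and the `n` Bobs are the parties `i.succ`.
Party `i` holds the Hilbert space `ℂ^(d i)`. -/

variable {n : ℕ}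

/-- Labels of the product basis of `⨂ i, ℂ^(d i)`. -/
abbrev Config (d : Fin (n + 1) → ℕ) : Type := (i : Fin (n + 1)) → Fin (d i)

/-- Operators on `⨂ i, ℂ^(d i)`. -/
abbrev Op (d : Fin (n + 1) → ℕ) : Type := Matrix (Config d) (Config d) ℂ

/-- The tensor product `⨂ i, M i` of one operator for each party. -/
def localProduct {d : Fin (n + 1) → ℕ} (M : (i : Fin (n + 1)) → Matrix (Fin (d i)) (Fin (d i)) ℂ) :
    Op d :=
  Matrix.of fun x y => ∏ i, M i (x i) (y i)

/-- Product basis labels of the parties in `S`. -/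
abbrev ConfigOn (d : Fin (n + 1) → ℕ) (S : Finset (Fin (n + 1))) : Type :=
  (i : {i : Fin (n + 1) // i ∈ S}) → Fin (d i)

/-- The tensor product of an operator of the parties in `S` and one of the parties in `Sᶜ`. -/
def bipartiteProduct {d : Fin (n + 1) → ℕ} (S : Finset (Fin (n + 1)))
    (τ : Matrix (ConfigOn d S) (ConfigOn d S) ℂ)
    (τ' : Matrix (ConfigOn d Sᶜ) (ConfigOn d Sᶜ) ℂ) : Op d :=
  Matrix.of fun x y =>
    τ (fun i => x i) (fun i => y i) * τ' (fun i => x i) (fun i => y i)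

/-- `ρ` is separable with respect to `S | Sᶜ`: a convex combination of products of a state of the
parties in `S` and a state of the parties in `Sᶜ`. -/
def SeparableAcross {d : Fin (n + 1) → ℕ} (S : Finset (Fin (n + 1))) (ρ : Op d) : Prop :=
  ∃ (m : ℕ) (q : Fin m → ℝ) (τ : Fin m → Matrix (ConfigOn d S) (ConfigOn d S) ℂ)
    (τ' : Fin m → Matrix (ConfigOn d Sᶜ) (ConfigOn d Sᶜ) ℂ),
    (∀ j, 0 ≤ q j) ∧ ∑ j, q j = 1 ∧ (∀ j, IsState (τ j)) ∧ (∀ j, IsState (τ' j)) ∧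
      ρ = ∑ j, q j • bipartiteProduct S (τ j) (τ' j)

/-- The union, over all bipartitions of the parties into two nonempty sets, of the sets of states
that are separable with respect to that bipartition. -/
def partitionSeparable (d : Fin (n + 1) → ℕ) : Set (Op d) :=
  {ρ | ∃ S : Finset (Fin (n + 1)), S.Nonempty ∧ S ≠ Finset.univ ∧ SeparableAcross S ρ}

/-- Biseparable states: convex combinations of states that are separable with respect to possibly
different bipartitions. -/
def IsBiseparable {d : Fin (n + 1) → ℕ} (ρ : Op d) : Prop :=
  ∃ (m : ℕ) (q : Fin m → ℝ) (σ : Fin m → Op d),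
    (∀ j, 0 ≤ q j) ∧ ∑ j, q j = 1 ∧ (∀ j, σ j ∈ partitionSeparable d) ∧ ρ = ∑ j, q j • σ j

/-- The local measurements of a conference key agreement protocol: each party has finitely many
measurement settings, and one of them is used in the key generation rounds. -/
structure Protocol (d : Fin (n + 1) → ℕ) where
  settings : Fin (n + 1) → ℕ
  outcomes : (i : Fin (n + 1)) → Fin (settings i) → ℕ
  povm : (i : Fin (n + 1)) → (x : Fin (settings i)) → POVM (d i) (outcomes i x)
  key : (i : Fin (n + 1)) → Fin (settings i)

/-- `P(a, b₁, …, bₙ | x, y₁, …, yₙ)`. -/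
def statistics {d : Fin (n + 1) → ℕ} (P : Protocol d) (ρ : Op d)
    (x : (i : Fin (n + 1)) → Fin (P.settings i))
    (a : (i : Fin (n + 1)) → Fin (P.outcomes i (x i))) : ℝ :=
  (localProduct (fun i => (P.povm i (x i)).effect (a i)) * ρ).trace.re

/-- Number of outcomes of the key generation measurement of party `i`. -/
abbrev keyOutcomes {d : Fin (n + 1) → ℕ} (P : Protocol d) (i : Fin (n + 1)) : ℕ :=
  P.outcomes i (P.key i)

/-- The effects of the key generation measurement of party `i`. -/
abbrev keyEffect {d : Fin (n + 1) → ℕ} (P : Protocol d) (i : Fin (n + 1))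
    (a : Fin (keyOutcomes P i)) : Matrix (Fin (d i)) (Fin (d i)) ℂ :=
  (P.povm i (P.key i)).effect a

/-- Joint distribution of the key generation outcomes `X` of Alice and `Yᵢ` of Bob `i`. -/
def keyDist {d : Fin (n + 1) → ℕ} (P : Protocol d) (ρ : Op d) (i : Fin n)
    (ab : Fin (keyOutcomes P 0) × Fin (keyOutcomes P i.succ)) : ℝ :=
  (localProduct (Function.update (Function.update
      (fun j => (1 : Matrix (Fin (d j)) (Fin (d j)) ℂ)) 0 (keyEffect P 0 ab.1))
      i.succ (keyEffect P i.succ ab.2)) * ρ).trace.re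

/-- `H(X|Yᵢ) = H(XYᵢ) - H(Yᵢ)`. -/
def condEntropyBob {d : Fin (n + 1) → ℕ} (P : Protocol d) (ρ : Op d) (i : Fin n) : ℝ :=
  shannonEntropy (keyDist P ρ i) - shannonEntropy (fun b => ∑ a, keyDist P ρ i (a, b))

/- A vector of `(⨂ i, ℂ^(d i)) ⊗ ℂ^m`, the second factor being held by Eve, is written as the
matrix `ψ` of its coefficients `ψ x e`. -/

/-- `Tr_E |ψ⟩⟨ψ|`, the operator shared by the parties. -/
def reduced {d : Fin (n + 1) → ℕ} {m : ℕ} (ψ : Matrix (Config d) (Fin m) ℂ) : Op d := ψ * ψᴴ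

/-- `ψ` is a purification of `ρ`, held by the parties and Eve. -/
def IsPurification {d : Fin (n + 1) → ℕ} {m : ℕ} (ψ : Matrix (Config d) (Fin m) ℂ)
    (ρ : Op d) : Prop :=
  reduced ψ = ρ

/-- Eve's unnormalised state when Alice obtains the key generation outcome `a`, that is
`Tr_{A B₁ … Bₙ} ((Gᵃ ⊗ 1 ⊗ ⋯ ⊗ 1) |ψ⟩⟨ψ|)`. -/
def eveState {d : Fin (n + 1) → ℕ} {m : ℕ} (P : Protocol d) (ψ : Matrix (Config d) (Fin m) ℂ)
    (a : Fin (keyOutcomes P 0)) : Matrix (Fin m) (Fin m) ℂ :=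
  (ψᴴ * localProduct (Function.update
    (fun j => (1 : Matrix (Fin (d j)) (Fin (d j)) ℂ)) 0 (keyEffect P 0 a)) * ψ)ᵀ

/-- `H(X|E) = H(XE) - H(E)`, for the classical-quantum state `∑ a, |a⟩⟨a| ⊗ eveState a`. -/
def condEntropyEve {d : Fin (n + 1) → ℕ} {m : ℕ} (P : Protocol d)
    (ψ : Matrix (Config d) (Fin m) ℂ) : ℝ :=
  vonNeumannEntropy (Matrix.blockDiagonal (eveState P ψ)) -
    vonNeumannEntropy (∑ a, eveState P ψ a)

/-- The asymptotic key rate `r_∞ = max (0, H(X|E) - max_i H(X|Yᵢ))`, for the pure state `ψ` of the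
parties and Eve. -/
def keyRate {d : Fin (n + 1) → ℕ} {m : ℕ} (P : Protocol d) (ψ : Matrix (Config d) (Fin m) ℂ) : ℝ :=
  max 0 (condEntropyEve P ψ - ⨆ i : Fin n, condEntropyBob P (reduced ψ) i)

end System

/-- Measurement of a qubit in the `Z` basis. -/
def zPOVM : POVM 2 2 where
  effect b := Matrix.vecMulVec (Pi.single b 1) (star (Pi.single b 1))
  posSemidef b := Matrix.posSemidef_vecMulVec_self_star _
  sum_eq_one := by
    ext i j
    fin_cases i <;> fin_cases j <;> simp [Matrix.vecMulVec]

/-- The vectors `|+⟩` and `|-⟩`. -/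
def xVec (b : Fin 2) : Fin 2 → ℂ :=
  ![((1 / √2 : ℝ) : ℂ), (((-1) ^ (b : ℕ) / √2 : ℝ) : ℂ)]

/-- Measurement of a qubit in the `X` basis. -/
def xPOVM : POVM 2 2 where
  effect b := Matrix.vecMulVec (xVec b) (star (xVec b))
  posSemidef b := Matrix.posSemidef_vecMulVec_self_star _
  sum_eq_one := by
    have h : ((√2 : ℝ) : ℂ) * ((√2 : ℝ) : ℂ) = 2 := by
      rw [← Complex.ofReal_mul, Real.mul_self_sqrt (by norm_num)]; norm_num
    have h0 : ((√2 : ℝ) : ℂ) ≠ 0 := by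
      intro h1; rw [h1] at h; norm_num at h
    ext i j
    fin_cases i <;> fin_cases j <;> simp [Matrix.vecMulVec, xVec] <;> field_simp <;>
      first | ring1 | linear_combination -h

/-- The N-BB84 protocol for `N = n + 1` qubits: setting `0` is the `Z` basis (key generation),
setting `1` is the `X` basis (parameter estimation). -/
def nBB84 (n : ℕ) : Protocol (fun _ : Fin (n + 1) => 2) where
  settings _ := 2
  outcomes _ _ := 2
  povm _ x := if x = 0 then zPOVM else xPOVM
  key _ := 0

end CKA

end

/-! A positive key rate fails on separable states because of the chain H(X|E) ≤ H(X|J) ≤ H(X|Yᵢ). If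
ρ = ∑ q_j τ_j ⊗ τ'_j across a cut, some Bob i is separated from Alice. Eve's entropies depend only
on ρ and not on the chosen purification (`spectralSum_conj_eq_of_mul_conjTranspose_eq`), so she may
be given one from which the label J can be read off (`exists_purification_of_mixture`). Measuring J
costs her information, which is the first inequality (`spectralSum_negMulLog_sub_le`). Given J, the
outcomes X and Yᵢ are independent, so the second one is concavity of -t log t
(`condEntropy_le_of_condIndep`).

The first inequality comes from monotonicity of the relative entropy under a projective measurement
(`relative_entropy_measurement_le`). The difference of the two relative entropies is the increase
over T ∈ [0, ∞) of a signed sum of terms log (b + T a). The derivative of this sum compares two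
quadratic forms, and a trial operator in the variational expression of the quantum one shows that it
is nonnegative.

A linear functional that is nonnegative on Σ is nonnegative on convex combinations. Non-convexity of
Σ follows from a zero pattern: a matrix element of a separable state vanishes when an associated
mixed population does (`SeparableAcross.apply_eq_zero`), and an equal mixture of two suitable
elements of Σ violates this for every cut.

The biseparable example mixes two states, each a GHZ state of all parties but one Bob, with that Bob
in |+⟩, for two different Bobs. Both components are fixed by X ⊗ ⋯ ⊗ X, which forces H(X|E) = 1,
while each Bob has error rate at most 1/4, so H(X|Yᵢ) < 1. Both facts can be read from the
statistics. A linear witness for a positive rate would be nonnegative on Σ, hence on this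
biseparable state, which is a contradiction. -/

noncomputable section

namespace CKA

/-! ### Spectral sums through characteristic polynomials, and independence of the purification -/

section SpectralSum

variable {κ μ o : Type*} [Fintype κ] [DecidableEq κ] [Fintype μ] [DecidableEq μ]

/-- The sum of `f` over the eigenvalues of `M`, with multiplicity. -/
def spectralSum (f : ℝ → ℝ) (M : Matrix κ κ ℂ) : ℝ :=
  (M.charpoly.roots.map fun z => f z.re).sum

theorem spectralSum_eq_sum_eigenvalues (f : ℝ → ℝ) {M : Matrix κ κ ℂ} (hM : M.IsHermitian) :
    spectralSum f M = ∑ i, f (hM.eigenvalues i) := by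
  simp [spectralSum, hM.roots_charpoly_eq_eigenvalues]

theorem re_trace_cfc (f : ℝ → ℝ) {M : Matrix κ κ ℂ} (hM : M.IsHermitian) :
    (cfc f M).trace.re = spectralSum f M := by
  rw [spectralSum_eq_sum_eigenvalues f hM, hM.cfc_eq, Matrix.IsHermitian.cfc,
    Unitary.conjStarAlgAut_apply, Matrix.trace_mul_comm, ← mul_assoc]
  simp [Matrix.trace]

theorem vonNeumannEntropy_eq {M : Matrix κ κ ℂ} (hM : M.IsHermitian) :
    vonNeumannEntropy M = spectralSum Real.negMulLog M / Real.log 2 := by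
  rw [vonNeumannEntropy, re_trace_cfc _ hM]

theorem spectralSum_transpose (f : ℝ → ℝ) (M : Matrix κ κ ℂ) :
    spectralSum f Mᵀ = spectralSum f M := by
  rw [spectralSum, Matrix.charpoly_transpose, spectralSum]

theorem charpoly_blockDiagonal [Fintype o] [DecidableEq o] (M : o → Matrix κ κ ℂ) :
    (Matrix.blockDiagonal M).charpoly = ∏ k, (M k).charpoly := by
  rw [Matrix.charpoly]
  have : (Matrix.blockDiagonal M).charmatrix = Matrix.blockDiagonal fun k => (M k).charmatrix := by
    ext ⟨i, k⟩ ⟨j, l⟩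
    by_cases hkl : k = l
    · subst hkl
      by_cases hij : i = j
      · subst hij; simp
      · rw [Matrix.charmatrix_apply_ne _ _ _ (by simp [hij]),
          Matrix.blockDiagonal_apply_eq, Matrix.blockDiagonal_apply_eq,
          Matrix.charmatrix_apply_ne _ _ _ hij]
    · rw [Matrix.charmatrix_apply_ne _ _ _ (by simp [hkl]), Matrix.blockDiagonal_apply_ne _ _ _ hkl,
        Matrix.blockDiagonal_apply_ne _ _ _ hkl]
      simp
  rw [this, Matrix.det_blockDiagonal]
  rfl

theorem spectralSum_blockDiagonal [Fintype o] [DecidableEq o] (f : ℝ → ℝ)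
    (M : o → Matrix κ κ ℂ) :
    spectralSum f (Matrix.blockDiagonal M) = ∑ k, spectralSum f (M k) := by
  rw [spectralSum, charpoly_blockDiagonal, Polynomial.roots_prod]
  · rw [Multiset.map_bind, Multiset.sum_bind]
    rfl
  · exact Finset.prod_ne_zero_iff.2 fun k _ => (M k).charpoly_monic.ne_zero

/-- The characteristic polynomials of A B and B A agree up to powers of the variable. The surplus
roots are zeros, and `f 0 = 0` makes them invisible. -/
theorem spectralSum_mul_comm {f : ℝ → ℝ} (hf : f 0 = 0) (A : Matrix κ μ ℂ) (B : Matrix μ κ ℂ) :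
    spectralSum f (A * B) = spectralSum f (B * A) := by
  have h := congrArg (fun p => (p.roots.map fun z => f z.re).sum) (Matrix.charpoly_mul_comm' A B)
  rw [Polynomial.roots_mul, Polynomial.roots_mul] at h
  · simpa [Multiset.map_nsmul, Multiset.sum_nsmul, hf, spectralSum] using h
  · exact mul_ne_zero (pow_ne_zero _ Polynomial.X_ne_zero) (B * A).charpoly_monic.ne_zero
  · exact mul_ne_zero (pow_ne_zero _ Polynomial.X_ne_zero) (A * B).charpoly_monic.ne_zero

end SpectralSum

open scoped MatrixOrder Matrix.Norms.L2Operator in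
theorem exists_eq_conjTranspose_mul_self {κ : Type*} [Fintype κ] [DecidableEq κ]
    {G : Matrix κ κ ℂ} (hG : G.PosSemidef) : ∃ g : Matrix κ κ ℂ, G = gᴴ * g :=
  CStarAlgebra.nonneg_iff_eq_star_mul_self.mp hG.nonneg

/-- The spectral sums of `φᴴ G φ` depend on `φ` only through `φ φᴴ`. -/
theorem spectralSum_conj_eq_of_mul_conjTranspose_eq {κ μ ν : Type*} [Fintype κ] [DecidableEq κ]
    [Fintype μ] [DecidableEq μ] [Fintype ν] [DecidableEq ν] {f : ℝ → ℝ} (hf : f 0 = 0)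
    {G : Matrix κ κ ℂ} (hG : G.PosSemidef)
    {φ : Matrix κ μ ℂ} {ψ : Matrix κ ν ℂ} (h : φ * φᴴ = ψ * ψᴴ) :
    spectralSum f (φᴴ * G * φ) = spectralSum f (ψᴴ * G * ψ) := by
  obtain ⟨g, rfl⟩ := exists_eq_conjTranspose_mul_self hG
  -- Reversing the two factors gives g (φ φᴴ) gᴴ, in which φ occurs only through φ φᴴ.
  rw [show φᴴ * (gᴴ * g) * φ = (φᴴ * gᴴ) * (g * φ) by simp only [Matrix.mul_assoc],
    show ψᴴ * (gᴴ * g) * ψ = (ψᴴ * gᴴ) * (g * ψ) by simp only [Matrix.mul_assoc],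
    spectralSum_mul_comm hf, spectralSum_mul_comm hf (ψᴴ * gᴴ),
    show g * φ * (φᴴ * gᴴ) = g * (φ * φᴴ) * gᴴ by simp only [Matrix.mul_assoc], h]
  simp only [Matrix.mul_assoc]

/-! ### Monotonicity of relative entropy under projective measurements -/

/-- If `∑ c = 0` and the derivative of `T ↦ ∑ c log (b + T a)` is nonnegative, then the value at
`T = 0` is at most the limit at infinity. -/
theorem sum_mul_log_le_of_sum_div_nonneg {ι : Type*} [Fintype ι] (c a b : ι → ℝ)
    (hpos : ∀ i, c i ≠ 0 → 0 < a i ∧ 0 < b i) (hc : ∑ i, c i = 0)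
    (hder : ∀ T : ℝ, 0 < T → 0 ≤ ∑ i, c i * (a i / (b i + T * a i))) :
    ∑ i, c i * Real.log (b i) ≤ ∑ i, c i * Real.log (a i) := by
  let g : ℝ → ℝ := fun T => ∑ i, c i * Real.log (b i + T * a i)
  have hg : ∀ T : ℝ, 0 ≤ T → HasDerivAt g (∑ i, c i * (a i / (b i + T * a i))) T := by
    intro T hT
    refine HasDerivAt.fun_sum fun i _ => ?_
    by_cases h : c i = 0
    · simpa [h] using hasDerivAt_const T (0 : ℝ)
    · obtain ⟨ha, hb⟩ := hpos i h
      have : HasDerivAt (fun T => b i + T * a i) (a i) T := by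
        simpa using ((hasDerivAt_id T).mul_const (a i)).const_add (b i)
      exact (this.log (by positivity)).const_mul (c i)
  have hmono : MonotoneOn g (Set.Ici 0) := by
    refine monotoneOn_of_deriv_nonneg (convex_Ici 0)
      (fun T hT => (hg T hT).continuousAt.continuousWithinAt)
      (fun T hT => ?_) (fun T hT => ?_)
    · rw [interior_Ici] at hT
      exact (hg T hT.le).differentiableAt.differentiableWithinAt
    · rw [interior_Ici] at hT
      rw [(hg T hT.le).deriv]
      exact hder T hT
  have hlim : Filter.Tendsto g Filter.atTop (nhds (∑ i, c i * Real.log (a i))) := by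
    have h1 : Filter.Tendsto (fun T : ℝ => ∑ i, c i * Real.log (b i * T⁻¹ + a i)) Filter.atTop
        (nhds (∑ i, c i * Real.log (a i))) := by
      refine tendsto_finsetSum _ fun i _ => ?_
      by_cases h : c i = 0
      · simp [h]
      · obtain ⟨ha, hb⟩ := hpos i h
        have h2 : Filter.Tendsto (fun T : ℝ => b i * T⁻¹ + a i) Filter.atTop (nhds (a i)) := by
          simpa using (tendsto_inv_atTop_zero.const_mul (b i)).add_const (a i)
        exact (h2.log ha.ne').const_mul (c i)
    refine h1.congr' ?_
    filter_upwards [Filter.eventually_gt_atTop 0] with T hT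
    -- Splitting off log T isolates the divergent part, whose coefficient is ∑ c = 0.
    have h3 : ∀ i, c i * Real.log (b i + T * a i) =
        c i * Real.log T + c i * Real.log (b i * T⁻¹ + a i) := by
      intro i
      by_cases h : c i = 0
      · simp [h]
      · obtain ⟨ha, hb⟩ := hpos i h
        rw [← mul_add, ← Real.log_mul hT.ne' (by positivity)]
        congr 2
        field_simp
    simp only [g, h3, Finset.sum_add_distrib, ← Finset.sum_mul, hc, zero_mul, zero_add]
  have h0 : g 0 = ∑ i, c i * Real.log (b i) := by simp [g]
  rw [← h0]
  refine ge_of_tendsto hlim ?_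
  filter_upwards [Filter.eventually_ge_atTop 0] with T hT
  exact hmono (Set.mem_Ici.2 le_rfl) hT hT

section Populations

variable {κ J : Type*} [Fintype κ] [DecidableEq J]

/-- The weights of the blocks `f ⁻¹' {j}` of basis vectors in the matrix `A`. -/
def population (f : κ → J) (A : Matrix κ κ ℂ) (j : J) : ℝ :=
  ∑ k, if f k = j then (A k k).re else 0

theorem sum_mul_population [Fintype J] (f : κ → J) (A : Matrix κ κ ℂ) (x : J → ℝ) :
    ∑ j, x j * population f A j = ∑ k, x (f k) * (A k k).re := by
  simp only [population, Finset.mul_sum]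
  rw [Finset.sum_comm]
  refine Finset.sum_congr rfl fun k _ => ?_
  simp

theorem population_sum {ι : Type*} [Fintype ι] (f : κ → J) (A : ι → Matrix κ κ ℂ) (j : J) :
    population f (∑ a, A a) j = ∑ a, population f (A a) j := by
  simp only [population, Matrix.sum_apply, Complex.re_sum]
  rw [Finset.sum_comm]
  refine Finset.sum_congr rfl fun k _ => ?_
  split_ifs <;> simp

theorem population_nonneg (f : κ → J) {A : Matrix κ κ ℂ} (hA : A.PosSemidef) (j : J) :
    0 ≤ population f A j := by
  refine Finset.sum_nonneg fun k _ => ?_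
  split_ifs
  · exact (Complex.le_def.1 (hA.diag_nonneg (i := k))).1
  · exact le_rfl

variable [DecidableEq κ]

theorem re_trace_conjTranspose_mul_diagonal_mul (a : κ → ℝ) (P Q : Matrix κ κ ℂ) :
    (Pᴴ * Matrix.diagonal (fun i => (a i : ℂ)) * Q).trace.re =
      ∑ ij : κ × κ, a ij.1 * (star (P ij.1 ij.2) * Q ij.1 ij.2).re := by
  rw [Fintype.sum_prod_type_right, Matrix.trace, Complex.re_sum]
  refine Finset.sum_congr rfl fun j _ => ?_
  rw [Matrix.diag_apply, Matrix.mul_apply, Complex.re_sum]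
  refine Finset.sum_congr rfl fun i _ => ?_
  rw [Matrix.mul_diagonal, Matrix.conjTranspose_apply, mul_comm (star _), mul_assoc,
    Complex.re_ofReal_mul]

theorem re_trace_mul_diagonal_mul_conjTranspose (b : κ → ℝ) (P : Matrix κ κ ℂ) :
    (P * Matrix.diagonal (fun i => (b i : ℂ)) * Pᴴ).trace.re =
      ∑ ij : κ × κ, b ij.2 * Complex.normSq (P ij.1 ij.2) := by
  rw [Fintype.sum_prod_type, Matrix.trace, Complex.re_sum]
  refine Finset.sum_congr rfl fun i _ => ?_
  rw [Matrix.diag_apply, Matrix.mul_apply, Complex.re_sum]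
  refine Finset.sum_congr rfl fun j _ => ?_
  rw [Matrix.mul_diagonal, Matrix.conjTranspose_apply, mul_comm (P i j), mul_assoc,
    Complex.re_ofReal_mul, ← starRingEnd_apply, Complex.mul_conj, Complex.ofReal_re]

variable [Fintype J]

theorem re_trace_diagonal_mul_mul_diagonal (f : κ → J) (A : Matrix κ κ ℂ) (x : J → ℝ) :
    (Matrix.diagonal (fun k => (x (f k) : ℂ)) * A *
      Matrix.diagonal (fun k => (x (f k) : ℂ))).trace.re = ∑ j, x j ^ 2 * population f A j := by
  rw [sum_mul_population f A fun j => x j ^ 2, Matrix.trace, Complex.re_sum]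
  refine Finset.sum_congr rfl fun k _ => ?_
  rw [Matrix.diag_apply, Matrix.mul_diagonal, Matrix.diagonal_mul, mul_right_comm,
    ← Complex.ofReal_mul, Complex.re_ofReal_mul, sq]

theorem re_trace_mul_diagonal (f : κ → J) (A : Matrix κ κ ℂ) (x : J → ℝ) :
    (A * Matrix.diagonal (fun k => (x (f k) : ℂ))).trace.re = ∑ j, x j * population f A j := by
  rw [sum_mul_population f A, Matrix.trace, Complex.re_sum]
  refine Finset.sum_congr rfl fun k _ => ?_
  rw [Matrix.diag_apply, Matrix.mul_diagonal, mul_comm, Complex.re_ofReal_mul]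

/-- Completing the square: for s > 0 the difference of the two sides is |a z - s y|² / s. For s = 0
both sides are zero, since then a = 0. -/
theorem two_mul_re_sub_le_div {a s : ℝ} (hs : 0 ≤ s) (has : s = 0 → a = 0) (z y : ℂ) :
    2 * (a * (star z * y).re) - s * Complex.normSq y ≤
      a * Complex.normSq z * (a / s) := by
  rcases hs.eq_or_lt with h | h
  · simp [has h.symm, ← h]
  · rw [← sub_nonneg]
    have : a * Complex.normSq z * (a / s) -
        (2 * (a * (star z * y).re) - s * Complex.normSq y) =
        Complex.normSq ((a : ℂ) * z - s * y) / s := by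
      simp only [Complex.normSq_apply, Complex.sub_re, Complex.sub_im, Complex.mul_re,
        Complex.mul_im, Complex.ofReal_re, Complex.ofReal_im, Complex.star_def, Complex.conj_re,
        Complex.conj_im]
      field_simp
      ring
    rw [this]
    exact div_nonneg (Complex.normSq_nonneg _) h.le

/-- The relative entropy does not increase under a projective measurement. -/
theorem relative_entropy_measurement_le (f : κ → J) {A B U V : Matrix κ κ ℂ} {a b : κ → ℝ}
    (hU : Uᴴ * U = 1) (hV : Vᴴ * V = 1)
    (hA : A = U * Matrix.diagonal (fun i => (a i : ℂ)) * Uᴴ)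
    (hB : B = V * Matrix.diagonal (fun i => (b i : ℂ)) * Vᴴ)
    (ha : ∀ i, 0 ≤ a i) (hb : ∀ i, 0 ≤ b i) (hAp : A.PosSemidef)
    (hAB : (B - A).PosSemidef) :
    ∑ j, ((Vᴴ * A * V) j j).re * Real.log (b j) +
        ∑ j, population f A j * Real.log (population f A j) ≤
      ∑ i, a i * Real.log (a i) + ∑ j, population f A j * Real.log (population f B j) := by
  have hU' : U * Uᴴ = 1 := mul_eq_one_comm.1 hU
  have hV' : V * Vᴴ = 1 := mul_eq_one_comm.1 hV
  set Z := Uᴴ * V with hZ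
  have hZZ : Z * Zᴴ = 1 := by
    rw [hZ, Matrix.conjTranspose_mul, Matrix.conjTranspose_conjTranspose, Matrix.mul_assoc,
      ← Matrix.mul_assoc V, hV', Matrix.one_mul, hU]
  have hVA : Vᴴ * A * V = Zᴴ * Matrix.diagonal (fun i => (a i : ℂ)) * Z := by
    rw [hA, hZ]
    simp only [Matrix.conjTranspose_mul, Matrix.conjTranspose_conjTranspose, Matrix.mul_assoc]
  have hVB : Vᴴ * B * V = Matrix.diagonal (fun i => (b i : ℂ)) := by
    rw [hB, show Vᴴ * (V * Matrix.diagonal (fun i => (b i : ℂ)) * Vᴴ) * V =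
      (Vᴴ * V) * Matrix.diagonal (fun i => (b i : ℂ)) * (Vᴴ * V) by
        simp only [Matrix.mul_assoc], hV, Matrix.one_mul, Matrix.mul_one]
  have hcol : ∀ j, ((Vᴴ * A * V) j j).re = ∑ i, a i * Complex.normSq (Z i j) := by
    intro j
    rw [hVA, Matrix.mul_apply, Complex.re_sum]
    refine Finset.sum_congr rfl fun i _ => ?_
    rw [Matrix.mul_diagonal, Matrix.conjTranspose_apply, mul_comm (star _), mul_assoc,
      Complex.re_ofReal_mul, ← starRingEnd_apply, ← Complex.normSq_eq_conj_mul_self,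
      Complex.ofReal_re]
  have hrow : ∀ i, ∑ j, Complex.normSq (Z i j) = 1 := by
    intro i
    have h := congrArg (fun M : Matrix κ κ ℂ => (M i i).re) hZZ
    simpa [Matrix.mul_apply, Complex.mul_conj] using h
  have hle : ∀ j, population f A j ≤ population f B j := by
    intro j
    have h := population_nonneg f hAB j
    rw [← sub_nonneg]
    refine h.trans_eq ?_
    simp only [population, ← Finset.sum_sub_distrib]
    refine Finset.sum_congr rfl fun k _ => ?_
    split_ifs <;> simp
  have hp := population_nonneg f hAp
  have hrow' : ∀ g : κ → ℝ, ∑ ij : κ × κ, a ij.1 * Complex.normSq (Z ij.1 ij.2) * g ij.1 =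
      ∑ i, a i * g i := by
    intro g
    rw [Fintype.sum_prod_type]
    refine Finset.sum_congr rfl fun i _ => ?_
    simp only [mul_right_comm _ _ (g i), ← Finset.mul_sum, hrow, mul_one]
  have htr : ∑ i, a i = ∑ j, population f A j := by
    have h1 := sum_mul_population f A fun _ => 1
    simp only [one_mul] at h1
    have h2 : A.trace.re = ∑ i, a i := by
      rw [hA, Matrix.trace_mul_comm, ← Matrix.mul_assoc, hU, Matrix.one_mul, Matrix.trace_diagonal,
        Complex.re_sum]
      simp only [Complex.ofReal_re]
    rw [h1, ← h2, Matrix.trace, Complex.re_sum]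
    rfl
  -- The weights a i |Z i j|², eigenvalues of A times overlaps of the two eigenbases, turn Tr A log
  -- A and Tr A log B into classical sums. The populations enter with the opposite sign, so both
  -- relative entropies sit in one signed sum of total weight zero.
  have key := sum_mul_log_le_of_sum_div_nonneg (ι := (κ × κ) ⊕ J)
    (Sum.elim (fun ij => a ij.1 * Complex.normSq (Z ij.1 ij.2)) (fun j => -population f A j))
    (Sum.elim (fun ij => a ij.1) (population f A))
    (Sum.elim (fun ij => b ij.2) (population f B)) ?_ ?_ ?_
  · simp only [Fintype.sum_sum_type, Sum.elim_inl, Sum.elim_inr, neg_mul,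
      Finset.sum_neg_distrib] at key
    rw [hrow' (fun i => Real.log (a i)), Fintype.sum_prod_type_right] at key
    simp only [hcol, Finset.sum_mul]
    linarith
  · rintro (⟨i, j⟩ | j) h
    · simp only [Sum.elim_inl] at h ⊢
      have hai : 0 < a i := (ha i).lt_of_ne fun h0 => h (by simp [← h0])
      refine ⟨hai, (hb j).lt_of_ne fun h0 => h ?_⟩
      -- Support condition: where B has eigenvalue zero, A ≤ B forces the corresponding diagonal
      -- entry of A, a sum of nonnegative terms, to vanish.
      have h1 := (Complex.le_def.1 ((hAB.conjTranspose_mul_mul_same V).diag_nonneg (i := j))).1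
      rw [Matrix.mul_sub, Matrix.sub_mul, hVB, Matrix.sub_apply, Complex.sub_re, hcol] at h1
      simp only [Matrix.diagonal_apply_eq, ← h0, Complex.zero_re, Complex.ofReal_zero] at h1
      have h2 : ∀ i, 0 ≤ a i * Complex.normSq (Z i j) := fun i =>
        mul_nonneg (ha i) (Complex.normSq_nonneg _)
      have h3 := Finset.single_le_sum (fun i _ => h2 i) (Finset.mem_univ i)
      linarith [h2 i]
    · simp only [Sum.elim_inr, ne_eq, neg_eq_zero] at h ⊢
      have h1 : 0 < population f A j := (hp j).lt_of_ne (Ne.symm h)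
      exact ⟨h1, h1.trans_le (hle j)⟩
  · simp only [Fintype.sum_sum_type, Sum.elim_inl, Sum.elim_inr, Finset.sum_neg_distrib, ← htr]
    have := hrow' fun _ => 1
    simp only [mul_one] at this
    rw [this, add_neg_cancel]
  · intro T hT
    simp only [Fintype.sum_sum_type, Sum.elim_inl, Sum.elim_inr]
    -- The optimiser of the classical quadratic form. Its block-constant extension X, written
    -- between the two eigenbases as Y, serves as the trial operator for the quantum form.
    let x : J → ℝ := fun j => population f A j / (population f B j + T * population f A j)
    let X : Matrix κ κ ℂ := Matrix.diagonal fun k => (x (f k) : ℂ)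
    have hXX : Xᴴ = X := by
      simp only [X, Matrix.diagonal_conjTranspose]
      congr 1
      ext k
      simp
    let Y := Uᴴ * X * V
    have s1 : ∑ ij : κ × κ, a ij.1 * (star (Z ij.1 ij.2) * Y ij.1 ij.2).re =
        ∑ j, x j * population f A j := by
      rw [← re_trace_conjTranspose_mul_diagonal_mul, ← re_trace_mul_diagonal]
      rw [show Zᴴ * Matrix.diagonal (fun i => (a i : ℂ)) * Y = Vᴴ * (A * X * V) by
        rw [hA]
        simp only [hZ, Y, Matrix.conjTranspose_mul, Matrix.conjTranspose_conjTranspose,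
          Matrix.mul_assoc], Matrix.trace_mul_comm, Matrix.mul_assoc, hV', Matrix.mul_one]
    have s2 : ∑ ij : κ × κ, a ij.1 * Complex.normSq (Y ij.1 ij.2) =
        ∑ j, x j ^ 2 * population f A j := by
      rw [← re_trace_diagonal_mul_mul_diagonal]
      have := re_trace_conjTranspose_mul_diagonal_mul a Y Y
      simp only [← starRingEnd_apply, ← Complex.normSq_eq_conj_mul_self,
        Complex.ofReal_re] at this
      rw [← this, show Yᴴ * Matrix.diagonal (fun i => (a i : ℂ)) * Y = Vᴴ * (X * A * X * V) by
        rw [hA]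
        simp only [Y, Matrix.conjTranspose_mul, Matrix.conjTranspose_conjTranspose,
          Matrix.mul_assoc, hXX], Matrix.trace_mul_comm, Matrix.mul_assoc, hV', Matrix.mul_one]
    have s3 : ∑ ij : κ × κ, b ij.2 * Complex.normSq (Y ij.1 ij.2) =
        ∑ j, x j ^ 2 * population f B j := by
      rw [← re_trace_diagonal_mul_mul_diagonal, ← re_trace_mul_diagonal_mul_conjTranspose,
        show Y * Matrix.diagonal (fun i => (b i : ℂ)) * Yᴴ = Uᴴ * (X * B * X * U) by
        rw [hB]
        simp only [Y, Matrix.conjTranspose_mul, Matrix.conjTranspose_conjTranspose,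
          Matrix.mul_assoc, hXX], Matrix.trace_mul_comm, Matrix.mul_assoc, hU', Matrix.mul_one]
    have hpt : ∀ ij : κ × κ, 2 * (a ij.1 * (star (Z ij.1 ij.2) * Y ij.1 ij.2).re) -
        (b ij.2 + T * a ij.1) * Complex.normSq (Y ij.1 ij.2) ≤
        a ij.1 * Complex.normSq (Z ij.1 ij.2) * (a ij.1 / (b ij.2 + T * a ij.1)) := by
      intro ij
      have h1 := ha ij.1
      have h2 := hb ij.2
      refine two_mul_re_sub_le_div (by positivity) (fun h => ?_) _ _
      have h3 : T * a ij.1 = 0 := by linarith [mul_nonneg hT.le h1]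
      exact (mul_eq_zero.1 h3).resolve_left hT.ne'
    have hsum := Finset.sum_le_sum fun ij (_ : ij ∈ Finset.univ) => hpt ij
    -- On the classical side x attains the maximum of 2 x p - x² (q + T p), so the bound for the
    -- trial operator is compared with an equality.
    have hJ : ∑ j, population f A j * (population f A j /
        (population f B j + T * population f A j)) =
        2 * (∑ j, x j * population f A j) - (∑ j, x j ^ 2 * population f B j +
          T * ∑ j, x j ^ 2 * population f A j) := by
      simp only [Finset.mul_sum, ← Finset.sum_add_distrib, ← Finset.sum_sub_distrib]
      refine Finset.sum_congr rfl fun j _ => ?_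
      simp only [x]
      by_cases h : population f B j + T * population f A j = 0
      · simp [h]
      · field_simp
        ring
    simp only [neg_mul, Finset.sum_neg_distrib, hJ]
    rw [Finset.sum_sub_distrib, ← Finset.mul_sum, s1] at hsum
    simp only [add_mul, Finset.sum_add_distrib, mul_assoc T, ← Finset.mul_sum, s2, s3] at hsum
    linarith

theorem exists_spectral_decomposition {A : Matrix κ κ ℂ} (hA : A.IsHermitian) :
    ∃ U : Matrix κ κ ℂ, Uᴴ * U = 1 ∧
      A = U * Matrix.diagonal (fun i => (hA.eigenvalues i : ℂ)) * Uᴴ := by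
  refine ⟨hA.eigenvectorUnitary, ?_, ?_⟩
  · rw [← Matrix.star_eq_conjTranspose]
    exact Unitary.coe_star_mul_self _
  · conv_lhs => rw [hA.spectral_theorem]
    rw [Unitary.conjStarAlgAut_apply]
    rfl

/-- The entropy of a classical register conditioned on a quantum system is at most its entropy
conditioned on the outcome of a projective measurement of that system. -/
theorem spectralSum_negMulLog_sub_le {ι : Type*} [Fintype ι] (f : κ → J)
    {σ : ι → Matrix κ κ ℂ} (hσ : ∀ a, (σ a).PosSemidef) :
    ∑ a, spectralSum Real.negMulLog (σ a) - spectralSum Real.negMulLog (∑ a, σ a) ≤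
      ∑ a, ∑ j, Real.negMulLog (population f (σ a) j) -
        ∑ j, Real.negMulLog (∑ a, population f (σ a) j) := by
  classical
  have hB : (∑ a, σ a).PosSemidef := Matrix.posSemidef_sum _ fun a _ => hσ a
  obtain ⟨V, hV, hBV⟩ := exists_spectral_decomposition hB.isHermitian
  set b := hB.isHermitian.eigenvalues with hb
  have h1 : ∀ a, ∑ j, ((Vᴴ * σ a * V) j j).re * Real.log (b j) +
        ∑ j, population f (σ a) j * Real.log (population f (σ a) j) ≤
      - spectralSum Real.negMulLog (σ a) +
        ∑ j, population f (σ a) j * Real.log (population f (∑ a, σ a) j) := by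
    intro a
    obtain ⟨U, hU, hAU⟩ := exists_spectral_decomposition (hσ a).isHermitian
    rw [spectralSum_eq_sum_eigenvalues _ (hσ a).isHermitian]
    have := relative_entropy_measurement_le f hU hV hAU hBV (hσ a).eigenvalues_nonneg
      hB.eigenvalues_nonneg (hσ a) ?_
    · simpa [Real.negMulLog] using this
    -- Each σ a is dominated by the total, because the remaining summands are positive semidefinite.
    · rw [← Finset.sum_erase_eq_sub (Finset.mem_univ a)]
      exact Matrix.posSemidef_sum _ fun a _ => hσ a
  -- Summing the relative entropies of σ a to the total over a gives the Holevo quantity, which is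
  -- minus the left-hand side of the goal.
  have h2 := Finset.sum_le_sum fun a (_ : a ∈ Finset.univ) => h1 a
  simp only [Finset.sum_add_distrib, Finset.sum_neg_distrib] at h2
  have h3 : ∑ a, ∑ j, ((Vᴴ * σ a * V) j j).re * Real.log (b j) =
      - spectralSum Real.negMulLog (∑ a, σ a) := by
    rw [Finset.sum_comm, spectralSum_eq_sum_eigenvalues _ hB.isHermitian, ← Finset.sum_neg_distrib]
    refine Finset.sum_congr rfl fun j _ => ?_
    rw [← Finset.sum_mul, ← Complex.re_sum, ← Matrix.sum_apply, ← Finset.sum_mul,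
      ← Finset.mul_sum, Real.negMulLog, neg_mul, neg_neg]
    congr 1
    have h4 : Vᴴ * (∑ a, σ a) * V = Matrix.diagonal (fun i => (b i : ℂ)) := by
      conv_lhs => rw [hBV]
      rw [show Vᴴ * (V * Matrix.diagonal (fun i => (b i : ℂ)) * Vᴴ) * V =
        (Vᴴ * V) * Matrix.diagonal (fun i => (b i : ℂ)) * (Vᴴ * V) by
          simp only [Matrix.mul_assoc], hV, Matrix.one_mul, Matrix.mul_one]
    rw [h4, Matrix.diagonal_apply_eq, Complex.ofReal_re]
  have h5 : ∑ a, ∑ j, population f (σ a) j * Real.log (population f (∑ a, σ a) j) =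
      - ∑ j, Real.negMulLog (∑ a, population f (σ a) j) := by
    rw [Finset.sum_comm, ← Finset.sum_neg_distrib]
    refine Finset.sum_congr rfl fun j _ => ?_
    rw [← Finset.sum_mul, population_sum, Real.negMulLog, neg_mul, neg_neg]
  rw [h3, h5] at h2
  simp only [Real.negMulLog, neg_mul, Finset.sum_neg_distrib] at h2 ⊢
  linarith

end Populations

/-! ### Classical conditional entropy -/

/-- Data processing for a register `X` that is independent of `Y` given `J`. -/
theorem condEntropy_le_of_condIndep {α β J : Type*} [Fintype α] [Fintype β] [Fintype J]
    (r : J → ℝ) (u : J → α → ℝ) (v : J → β → ℝ) (hr : ∀ j, 0 ≤ r j)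
    (hu : ∀ j a, 0 ≤ u j a) (hv : ∀ j b, 0 ≤ v j b)
    (hu1 : ∀ j, ∑ a, u j a = 1) (hv1 : ∀ j, ∑ b, v j b = 1) :
    ∑ a, ∑ j, Real.negMulLog (r j * u j a) - ∑ j, Real.negMulLog (∑ a, r j * u j a) ≤
      ∑ ab : α × β, Real.negMulLog (∑ j, r j * u j ab.1 * v j ab.2) -
        ∑ b, Real.negMulLog (∑ a, ∑ j, r j * u j a * v j b) := by
  -- The left side is the average over j of the entropy of `u j`. Inserting ∑ v = 1 allows a
  -- comparison separately for each b.
  have hl : ∑ a, ∑ j, Real.negMulLog (r j * u j a) - ∑ j, Real.negMulLog (∑ a, r j * u j a) =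
      ∑ b, ∑ a, ∑ j, r j * v j b * Real.negMulLog (u j a) := by
    rw [Finset.sum_comm, ← Finset.sum_sub_distrib, Finset.sum_congr rfl fun b _ => Finset.sum_comm,
      Finset.sum_comm]
    refine Finset.sum_congr rfl fun j _ => ?_
    simp only [← Finset.mul_sum, hu1, mul_one, Real.negMulLog_mul, Finset.sum_add_distrib,
      ← Finset.sum_mul, hv1, one_mul]
    ring
  have hp : ∀ b, ∑ a, ∑ j, r j * u j a * v j b = ∑ j, r j * v j b := by
    intro b
    rw [Finset.sum_comm]
    refine Finset.sum_congr rfl fun j _ => ?_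
    rw [← Finset.sum_mul, ← Finset.mul_sum, hu1, mul_one]
  rw [hl, Fintype.sum_prod_type_right, ← Finset.sum_sub_distrib]
  refine Finset.sum_le_sum fun b _ => ?_
  rw [hp]
  have hw : ∀ j, 0 ≤ r j * v j b := fun j => mul_nonneg (hr j) (hv j b)
  -- Outcomes b of probability zero are treated apart, since the Jensen weights are conditional
  -- probabilities of j given b.
  rcases (Finset.sum_nonneg fun j (_ : j ∈ Finset.univ) => hw j).eq_or_lt with h0 | h0
  · have hz : ∀ j, r j * v j b = 0 := fun j =>
      (Finset.sum_eq_zero_iff_of_nonneg fun j _ => hw j).1 h0.symm j (Finset.mem_univ j)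
    simp [hz, mul_right_comm (r _) (u _ _)]
  · set s := ∑ j, r j * v j b with hs
    have hJ : ∀ a, ∑ j, r j * v j b * Real.negMulLog (u j a) ≤
        s * Real.negMulLog ((∑ j, r j * u j a * v j b) / s) := by
      intro a
      have := Real.concaveOn_negMulLog.le_map_sum (t := Finset.univ)
        (w := fun j => r j * v j b / s) (p := fun j => u j a)
        (fun j _ => div_nonneg (hw j) h0.le)
        (by rw [← Finset.sum_div, ← hs, div_self h0.ne']) (fun j _ => hu j a)
      have h1 := mul_le_mul_of_nonneg_left this h0.le
      rw [Finset.mul_sum] at h1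
      refine le_trans (le_of_eq ?_) (h1.trans (le_of_eq ?_))
      · refine Finset.sum_congr rfl fun j _ => ?_
        rw [smul_eq_mul]
        field_simp
      · congr 2
        rw [Finset.sum_div]
        refine Finset.sum_congr rfl fun j _ => ?_
        rw [smul_eq_mul]
        ring
    refine (Finset.sum_le_sum fun a _ => hJ a).trans (le_of_eq ?_)
    have h2 : ∀ a, s * Real.negMulLog ((∑ j, r j * u j a * v j b) / s) =
        Real.negMulLog (∑ j, r j * u j a * v j b) -
          (∑ j, r j * u j a * v j b) / s * Real.negMulLog s := by
      intro a
      have h3 := Real.negMulLog_mul ((∑ j, r j * u j a * v j b) / s) s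
      rw [div_mul_cancel₀ _ h0.ne'] at h3
      linarith
    simp only [h2, Finset.sum_sub_distrib, ← Finset.sum_mul, ← Finset.sum_div, hp, ← hs,
      div_self h0.ne', one_mul]

/-! ### Products across a bipartition -/

section Tensor

variable {n : ℕ} {d : Fin (n + 1) → ℕ}

/-- The tensor product of the operators `M i` of the parties in `S`. -/
def localProductOn (S : Finset (Fin (n + 1)))
    (M : (i : Fin (n + 1)) → Matrix (Fin (d i)) (Fin (d i)) ℂ) :
    Matrix (ConfigOn d S) (ConfigOn d S) ℂ :=
  Matrix.of fun x y => ∏ i : {i // i ∈ S}, M i (x i) (y i)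

/-- Splitting the product basis labels according to a bipartition of the parties. -/
def splitConfig (d : Fin (n + 1) → ℕ) (S : Finset (Fin (n + 1))) :
    Config d ≃ ConfigOn d S × ConfigOn d Sᶜ where
  toFun x := (fun i => x i, fun i => x i)
  invFun p i := if h : i ∈ S then p.1 ⟨i, h⟩ else p.2 ⟨i, Finset.mem_compl.2 h⟩
  left_inv x := by
    ext i
    by_cases h : i ∈ S <;> simp [h]
  right_inv p := by
    ext i
    · simp [i.2]
    · simp [Finset.mem_compl.1 i.2]

theorem bipartiteProduct_eq_submatrix_kronecker (S : Finset (Fin (n + 1)))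
    (τ : Matrix (ConfigOn d S) (ConfigOn d S) ℂ) (τ' : Matrix (ConfigOn d Sᶜ) (ConfigOn d Sᶜ) ℂ) :
    bipartiteProduct S τ τ' =
      (Matrix.kroneckerMap (· * ·) τ τ').submatrix (splitConfig d S) (splitConfig d S) := rfl

theorem bipartiteProduct_mul (S : Finset (Fin (n + 1)))
    (τ υ : Matrix (ConfigOn d S) (ConfigOn d S) ℂ)
    (τ' υ' : Matrix (ConfigOn d Sᶜ) (ConfigOn d Sᶜ) ℂ) :
    bipartiteProduct S τ τ' * bipartiteProduct S υ υ' =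
      bipartiteProduct S (τ * υ) (τ' * υ') := by
  simp only [bipartiteProduct_eq_submatrix_kronecker, Matrix.submatrix_mul_equiv]
  rw [← Matrix.mul_kronecker_mul]

theorem trace_bipartiteProduct (S : Finset (Fin (n + 1)))
    (τ : Matrix (ConfigOn d S) (ConfigOn d S) ℂ)
    (τ' : Matrix (ConfigOn d Sᶜ) (ConfigOn d Sᶜ) ℂ) :
    (bipartiteProduct S τ τ').trace = τ.trace * τ'.trace := by
  rw [bipartiteProduct_eq_submatrix_kronecker, ← Matrix.trace_kronecker]
  exact (splitConfig d S).sum_comp fun p => (Matrix.kroneckerMap (· * ·) τ τ') p p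

theorem posSemidef_bipartiteProduct (S : Finset (Fin (n + 1)))
    {τ : Matrix (ConfigOn d S) (ConfigOn d S) ℂ}
    {τ' : Matrix (ConfigOn d Sᶜ) (ConfigOn d Sᶜ) ℂ} (h : τ.PosSemidef) (h' : τ'.PosSemidef) :
    (bipartiteProduct S τ τ').PosSemidef :=
  (h.kronecker h').submatrix (splitConfig d S)

theorem localProduct_eq_bipartiteProduct (S : Finset (Fin (n + 1)))
    (M : (i : Fin (n + 1)) → Matrix (Fin (d i)) (Fin (d i)) ℂ) :
    localProduct M = bipartiteProduct S (localProductOn S M) (localProductOn Sᶜ M) := by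
  ext x y
  simp only [localProduct, bipartiteProduct, localProductOn, Matrix.of_apply]
  rw [Finset.prod_coe_sort S fun i => M i (x i) (y i),
    Finset.prod_coe_sort Sᶜ fun i => M i (x i) (y i), Finset.prod_mul_prod_compl]

theorem localProductOn_congr {S : Finset (Fin (n + 1))}
    {M N : (i : Fin (n + 1)) → Matrix (Fin (d i)) (Fin (d i)) ℂ} (h : ∀ i ∈ S, M i = N i) :
    localProductOn S M = localProductOn S N := by
  ext x y
  simp only [localProductOn, Matrix.of_apply]
  exact Finset.prod_congr rfl fun i _ => by rw [h i i.2]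

theorem localProductOn_one (S : Finset (Fin (n + 1))) :
    localProductOn (d := d) S (fun _ => 1) = 1 := by
  ext x y
  simp only [localProductOn, Matrix.of_apply, Matrix.one_apply, Finset.prod_boole]
  simp [funext_iff]

theorem localProduct_one : localProduct (d := d) (fun _ => 1) = 1 := by
  ext x y
  simp only [localProduct, Matrix.of_apply, Matrix.one_apply, Finset.prod_boole]
  simp [funext_iff]

theorem localProduct_mul (M N : (i : Fin (n + 1)) → Matrix (Fin (d i)) (Fin (d i)) ℂ) :
    localProduct M * localProduct N = localProduct fun i => M i * N i := by
  ext x y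
  simp only [localProduct, Matrix.mul_apply, Matrix.of_apply, ← Finset.prod_mul_distrib]
  rw [Finset.prod_univ_sum, Fintype.piFinset_univ]

theorem conjTranspose_localProduct
    (M : (i : Fin (n + 1)) → Matrix (Fin (d i)) (Fin (d i)) ℂ) :
    (localProduct M)ᴴ = localProduct fun i => (M i)ᴴ := by
  ext x y
  simp [localProduct, Matrix.conjTranspose_apply]

theorem posSemidef_localProduct {M : (i : Fin (n + 1)) → Matrix (Fin (d i)) (Fin (d i)) ℂ}
    (h : ∀ i, (M i).PosSemidef) : (localProduct M).PosSemidef := by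
  choose B hB using fun i => exists_eq_conjTranspose_mul_self (h i)
  rw [show localProduct M = (localProduct B)ᴴ * localProduct B by
    rw [conjTranspose_localProduct, localProduct_mul]
    exact congrArg _ (funext hB)]
  exact Matrix.posSemidef_conjTranspose_mul_self _

theorem sum_localProduct_update {ι : Type*} [Fintype ι]
    (M : (i : Fin (n + 1)) → Matrix (Fin (d i)) (Fin (d i)) ℂ) (i : Fin (n + 1))
    (N : ι → Matrix (Fin (d i)) (Fin (d i)) ℂ) :
    ∑ a, localProduct (Function.update M i (N a)) =
      localProduct (Function.update M i (∑ a, N a)) := by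
  ext x y
  simp only [Matrix.sum_apply, localProduct, Matrix.of_apply]
  have h : ∀ K : Matrix (Fin (d i)) (Fin (d i)) ℂ,
      ∏ j, Function.update M i K j (x j) (y j) =
        K (x i) (y i) * ∏ j ∈ Finset.univ.erase i, M j (x j) (y j) := by
    intro K
    rw [← Finset.mul_prod_erase _ _ (Finset.mem_univ i), Function.update_self]
    congr 1
    refine Finset.prod_congr rfl fun j hj => ?_
    rw [Function.update_of_ne (Finset.ne_of_mem_erase hj)]
  simp only [h, Matrix.sum_apply, Finset.sum_mul]

theorem update_one_self (i : Fin (n + 1)) :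
    Function.update (fun j => (1 : Matrix (Fin (d j)) (Fin (d j)) ℂ)) i 1 = fun _ => 1 :=
  Function.update_eq_self i _

theorem trace_localProduct_mul_bipartiteProduct (S : Finset (Fin (n + 1)))
    (M : (i : Fin (n + 1)) → Matrix (Fin (d i)) (Fin (d i)) ℂ)
    (τ : Matrix (ConfigOn d S) (ConfigOn d S) ℂ)
    (τ' : Matrix (ConfigOn d Sᶜ) (ConfigOn d Sᶜ) ℂ) :
    (localProduct M * bipartiteProduct S τ τ').trace =
      (localProductOn S M * τ).trace * (localProductOn Sᶜ M * τ').trace := by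
  rw [localProduct_eq_bipartiteProduct S, bipartiteProduct_mul, trace_bipartiteProduct]

/-- Measurements on different sides of a product state are independent. -/
theorem trace_localProduct_update_update_mul {S : Finset (Fin (n + 1))} {i j : Fin (n + 1)}
    (hij : ¬ (i ∈ S ↔ j ∈ S)) (K : Matrix (Fin (d i)) (Fin (d i)) ℂ)
    (L : Matrix (Fin (d j)) (Fin (d j)) ℂ)
    {τ : Matrix (ConfigOn d S) (ConfigOn d S) ℂ} {τ' : Matrix (ConfigOn d Sᶜ) (ConfigOn d Sᶜ) ℂ}
    (hτ : τ.trace = 1) (hτ' : τ'.trace = 1) :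
    (localProduct (Function.update (Function.update (fun _ => 1) i K) j L) *
        bipartiteProduct S τ τ').trace =
      (localProduct (Function.update (fun _ => 1) i K) * bipartiteProduct S τ τ').trace *
      (localProduct (Function.update (fun _ => 1) j L) * bipartiteProduct S τ τ').trace := by
  have hne : ∀ {T : Finset (Fin (n + 1))} {k l : Fin (n + 1)}, k ∉ T → l ∈ T → l ≠ k :=
    fun hk hl h => hk (h ▸ hl)
  have h1 : ∀ {T : Finset (Fin (n + 1))}, i ∉ T → localProductOn T
      (Function.update (Function.update (fun _ => 1) i K) j L) =
        localProductOn T (Function.update (fun _ => 1) j L) := by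
    intro T hi
    refine localProductOn_congr fun l hl => ?_
    by_cases hlj : l = j
    · subst hlj; simp
    · simp [Function.update_of_ne hlj, Function.update_of_ne (hne hi hl)]
  have h2 : ∀ {T : Finset (Fin (n + 1))}, j ∉ T → localProductOn T
      (Function.update (Function.update (fun _ => 1) i K) j L) =
        localProductOn T (Function.update (fun _ => 1) i K) := fun hj =>
    localProductOn_congr fun l hl => by rw [Function.update_of_ne (hne hj hl)]
  have h3 : ∀ {T : Finset (Fin (n + 1))} {k : Fin (n + 1)} {N}, k ∉ T → localProductOn T
      (Function.update (fun j => (1 : Matrix (Fin (d j)) (Fin (d j)) ℂ)) k N) = 1 := by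
    intro T k N hk
    rw [← localProductOn_one (d := d) T]
    exact localProductOn_congr fun l hl => by rw [Function.update_of_ne (hne hk hl)]
  simp only [trace_localProduct_mul_bipartiteProduct]
  -- Each side of the cut sees only one of the operators K and L. The factors without a measurement
  -- are traces of states, equal to 1.
  by_cases hi : i ∈ S
  · have hj : j ∉ S := fun hj => hij (iff_of_true hi hj)
    have hi' : i ∉ Sᶜ := by simpa using hi
    rw [h2 hj, h1 hi', h3 hj, h3 hi', Matrix.one_mul, Matrix.one_mul, hτ, hτ', mul_one, one_mul]
  · have hj : j ∈ S := by
      by_contra hj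
      exact hij (iff_of_false hi hj)
    have hj' : j ∉ Sᶜ := by simpa using hj
    rw [h1 hi, h2 hj', h3 hi, h3 hj', Matrix.one_mul, Matrix.one_mul, hτ, hτ', mul_one, one_mul,
      mul_comm]

end Tensor

theorem trace_mul_nonneg {κ : Type*} [Fintype κ] [DecidableEq κ] {A B : Matrix κ κ ℂ}
    (hA : A.PosSemidef) (hB : B.PosSemidef) : 0 ≤ (A * B).trace := by
  obtain ⟨g, rfl⟩ := exists_eq_conjTranspose_mul_self hB
  rw [← Matrix.mul_assoc, Matrix.trace_mul_comm, ← Matrix.mul_assoc]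
  exact (hA.mul_mul_conjTranspose_same g).trace_nonneg

/-! ### Vanishing of the key rate on separable states -/

section Separable

variable {n : ℕ} {d : Fin (n + 1) → ℕ}

/-- The effect of Alice's key generation outcome `a`, as an operator of all parties. -/
abbrev aliceEffect (P : Protocol d) (a : Fin (keyOutcomes P 0)) : Op d :=
  localProduct (Function.update (fun j => (1 : Matrix (Fin (d j)) (Fin (d j)) ℂ)) 0
    (keyEffect P 0 a))

theorem posSemidef_localProduct_update (i : Fin (n + 1)) {K : Matrix (Fin (d i)) (Fin (d i)) ℂ}
    (hK : K.PosSemidef) :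
    (localProduct (Function.update (fun j => (1 : Matrix (Fin (d j)) (Fin (d j)) ℂ)) i
      K)).PosSemidef := by
  refine posSemidef_localProduct fun j => ?_
  by_cases h : j = i
  · subst h; simpa using hK
  · rw [Function.update_of_ne h]; exact Matrix.PosSemidef.one

theorem sum_localProduct_keyEffect (P : Protocol d) (i : Fin (n + 1)) :
    ∑ a, localProduct (Function.update (fun j => (1 : Matrix (Fin (d j)) (Fin (d j)) ℂ)) i
      (keyEffect P i a)) = 1 := by
  rw [sum_localProduct_update, (P.povm i (P.key i)).sum_eq_one, update_one_self, localProduct_one]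

theorem posSemidef_eveState (P : Protocol d) {m : ℕ} (ψ : Matrix (Config d) (Fin m) ℂ)
    (a : Fin (keyOutcomes P 0)) : (eveState P ψ a).PosSemidef :=
  ((posSemidef_localProduct_update 0
    ((P.povm 0 (P.key 0)).posSemidef a)).conjTranspose_mul_mul_same ψ).transpose

theorem condEntropyEve_eq_spectralSum (P : Protocol d) {m : ℕ} (ψ : Matrix (Config d) (Fin m) ℂ) :
    condEntropyEve P ψ = (∑ a, spectralSum Real.negMulLog (eveState P ψ a) -
      spectralSum Real.negMulLog (∑ a, eveState P ψ a)) / Real.log 2 := by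
  have h := posSemidef_eveState P ψ
  rw [condEntropyEve, vonNeumannEntropy_eq, vonNeumannEntropy_eq, spectralSum_blockDiagonal,
    sub_div]
  · exact (Matrix.posSemidef_sum _ fun a _ => h a).isHermitian
  · rw [Matrix.IsHermitian, Matrix.blockDiagonal_conjTranspose]
    exact congrArg _ (funext fun a => (h a).isHermitian)

/-- A purification of `∑ q j • R j` from which the label `j` can be read off. -/
theorem exists_purification_of_mixture {κ : Type*} [Fintype κ] [DecidableEq κ] {m : ℕ}
    {q : Fin m → ℝ} {R : Fin m → Matrix κ κ ℂ} (hq : ∀ j, 0 ≤ q j)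
    (hR : ∀ j, (R j).PosSemidef) :
    ∃ Φ : Matrix κ (Fin m × κ) ℂ, Φ * Φᴴ = ∑ j, q j • R j ∧ ∀ (G : Matrix κ κ ℂ) (j : Fin m),
      population Prod.fst (Φᴴ * G * Φ) j = q j * (G * R j).trace.re := by
  choose g hg using fun j => exists_eq_conjTranspose_mul_self (hR j)
  have hs : ∀ j, ((√(q j) : ℝ) : ℂ) * ((√(q j) : ℝ) : ℂ) = (q j : ℂ) := fun j => by
    rw [← Complex.ofReal_mul, Real.mul_self_sqrt (hq j)]
  -- Eve's first factor records j with amplitude √(q j), and her second factor purifies `R j`.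
  refine ⟨Matrix.of fun x p => ((√(q p.1) : ℝ) : ℂ) * star (g p.1 p.2 x), ?_, fun G j => ?_⟩
  · ext x y
    rw [Matrix.mul_apply, Fintype.sum_prod_type, Matrix.sum_apply]
    refine Finset.sum_congr rfl fun j _ => ?_
    rw [hg j, Matrix.smul_apply, Matrix.mul_apply, Finset.smul_sum]
    refine Finset.sum_congr rfl fun k _ => ?_
    simp only [Matrix.conjTranspose_apply, Matrix.of_apply, star_mul', Complex.conj_conj,
      Complex.star_def, Complex.conj_ofReal, Complex.real_smul]
    rw [← hs j]
    ring
  · have h1 : (G * R j).trace = (g j * G * (g j)ᴴ).trace := by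
      rw [hg j, ← Matrix.mul_assoc, Matrix.trace_mul_comm, ← Matrix.mul_assoc]
    rw [h1, population, Fintype.sum_prod_type]
    simp only
    rw [Finset.sum_comm, Matrix.trace, Complex.re_sum, Finset.mul_sum]
    refine Finset.sum_congr rfl fun k _ => ?_
    rw [Finset.sum_ite_eq' Finset.univ j, if_pos (Finset.mem_univ j), ← Complex.re_ofReal_mul]
    congr 1
    simp only [Matrix.diag_apply, Matrix.mul_apply, Matrix.conjTranspose_apply, Matrix.of_apply,
      star_mul', Complex.conj_conj, Complex.star_def, Complex.conj_ofReal, Finset.mul_sum, Finset.sum_mul]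
    refine Finset.sum_congr rfl fun x _ => Finset.sum_congr rfl fun y _ => ?_
    rw [← hs j]
    ring

/-- The label of the product term is accessible to Eve and screens off Alice from a Bob on the other
side of the cut, so Eve is at least as well informed about X as this Bob. -/
theorem condEntropyEve_le_condEntropyBob (P : Protocol d) {S : Finset (Fin (n + 1))} {ρ : Op d}
    (hρ : SeparableAcross S ρ) {i : Fin n} (hi : ¬ (0 ∈ S ↔ i.succ ∈ S)) {m : ℕ}
    {ψ : Matrix (Config d) (Fin m) ℂ} (hψ : IsPurification ψ ρ) :
    condEntropyEve P ψ ≤ condEntropyBob P ρ i := by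
  obtain ⟨k, q, τ, τ', hq, -, hτ, hτ', hsum⟩ := hρ
  let R : Fin k → Op d := fun j => bipartiteProduct S (τ j) (τ' j)
  have hR : ∀ j, (R j).PosSemidef := fun j => posSemidef_bipartiteProduct S (hτ j).1 (hτ' j).1
  have hRtr : ∀ j, (R j).trace = 1 := fun j => by
    rw [trace_bipartiteProduct, (hτ j).2, (hτ' j).2, one_mul]
  obtain ⟨Φ, hΦ, hpop⟩ := exists_purification_of_mixture hq hR
  have hΦψ : ψ * ψᴴ = Φ * Φᴴ := by rw [hΦ, ← hsum]; exact hψ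
  let G : Fin (keyOutcomes P 0) → Op d := aliceEffect P
  let F : Fin (keyOutcomes P i.succ) → Op d := fun b => localProduct
    (Function.update (fun j => (1 : Matrix (Fin (d j)) (Fin (d j)) ℂ)) i.succ
      (keyEffect P i.succ b))
  have hG : ∀ a, (G a).PosSemidef := fun a =>
    posSemidef_localProduct_update 0 ((P.povm 0 (P.key 0)).posSemidef a)
  have hF : ∀ b, (F b).PosSemidef := fun b =>
    posSemidef_localProduct_update _ ((P.povm i.succ (P.key i.succ)).posSemidef b)
  have hG1 : ∑ a, G a = 1 := sum_localProduct_keyEffect P 0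
  have hF1 : ∑ b, F b = 1 := sum_localProduct_keyEffect P i.succ
  have hη := Real.negMulLog_zero
  have hE1 : ∀ a, spectralSum Real.negMulLog (eveState P ψ a) =
      spectralSum Real.negMulLog (Φᴴ * G a * Φ) := fun a => by
    rw [eveState, spectralSum_transpose, spectralSum_conj_eq_of_mul_conjTranspose_eq hη (hG a) hΦψ]
  have hE2 : spectralSum Real.negMulLog (∑ a, eveState P ψ a) =
      spectralSum Real.negMulLog (∑ a, Φᴴ * G a * Φ) := by
    have h1 : ∑ a, eveState P ψ a = (ψᴴ * (∑ a, G a) * ψ)ᵀ := by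
      rw [Matrix.mul_sum, Matrix.sum_mul, Matrix.transpose_sum]
      rfl
    rw [h1, spectralSum_transpose, ← Matrix.sum_mul, ← Matrix.mul_sum]
    exact spectralSum_conj_eq_of_mul_conjTranspose_eq hη
      (Matrix.posSemidef_sum _ fun a _ => hG a) hΦψ
  -- H(X|E) ≤ H(X|J): Eve measures the label register of Φ.
  have hholevo := spectralSum_negMulLog_sub_le (Prod.fst : Fin k × Config d → Fin k)
    fun a => (hG a).conjTranspose_mul_mul_same Φ
  simp only [hpop] at hholevo
  have hsum1 : ∀ {ι : Type} [Fintype ι] (K : ι → Op d), ∑ a, K a = 1 → ∀ j,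
      ∑ a, (K a * R j).trace.re = 1 := by
    intro ι _ K hK j
    rw [← Complex.re_sum, ← Matrix.trace_sum, ← Finset.sum_mul, hK, Matrix.one_mul, hRtr,
      Complex.one_re]
  -- H(X|J) ≤ H(X|Yᵢ). That this bound concerns the actual key distribution is `hdist`, where the
  -- cut between Alice and Bob i is used.
  have hclass := condEntropy_le_of_condIndep q (fun j a => (G a * R j).trace.re)
    (fun j b => (F b * R j).trace.re) hq
    (fun j a => (Complex.le_def.1 (trace_mul_nonneg (hG a) (hR j))).1)
    (fun j b => (Complex.le_def.1 (trace_mul_nonneg (hF b) (hR j))).1)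
    (hsum1 G hG1) (hsum1 F hF1)
  have hdist : ∀ ab, keyDist P ρ i ab =
      ∑ j, q j * (G ab.1 * R j).trace.re * (F ab.2 * R j).trace.re := by
    intro ab
    rw [keyDist, hsum, Finset.mul_sum, Matrix.trace_sum, Complex.re_sum]
    refine Finset.sum_congr rfl fun j _ => ?_
    rw [Matrix.mul_smul, Matrix.trace_smul, Complex.smul_re,
      trace_localProduct_update_update_mul hi _ _ (hτ j).2 (hτ' j).2, Complex.mul_re]
    have him : (G ab.1 * R j).trace.im = 0 :=
      (Complex.le_def.1 (trace_mul_nonneg (hG ab.1) (hR j))).2.symm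
    have him' : (aliceEffect P ab.1 * bipartiteProduct S (τ j) (τ' j)).trace.im = 0 := him
    rw [him', zero_mul, sub_zero, smul_eq_mul, mul_assoc]
  rw [condEntropyEve_eq_spectralSum, condEntropyBob, shannonEntropy, shannonEntropy, ← sub_div]
  refine div_le_div_of_nonneg_right ?_ (Real.log_nonneg one_le_two)
  simp only [hE1, hE2, hdist]
  exact hholevo.trans hclass

theorem keyRate_eq_zero_of_separableAcross (P : Protocol d) {S : Finset (Fin (n + 1))}
    (hS : S.Nonempty) (hS' : S ≠ Finset.univ) {ρ : Op d} (hρ : SeparableAcross S ρ) {m : ℕ}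
    {ψ : Matrix (Config d) (Fin m) ℂ} (hψ : IsPurification ψ ρ) : keyRate P ψ = 0 := by
  obtain ⟨i, hi⟩ : ∃ i : Fin n, ¬ (0 ∈ S ↔ i.succ ∈ S) := by
    by_contra! h
    have h' : ∀ i, 0 ∈ S ↔ i ∈ S := Fin.cases Iff.rfl h
    obtain ⟨k, hk⟩ := hS
    exact hS' (Finset.eq_univ_of_forall fun i => (h' i).1 ((h' k).2 hk))
  have h1 := condEntropyEve_le_condEntropyBob P hρ hi hψ
  have h2 : condEntropyBob P ρ i ≤ ⨆ i, condEntropyBob P ρ i :=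
    le_ciSup (Set.finite_range _).bddAbove i
  rw [keyRate, show reduced ψ = ρ from hψ]
  exact max_eq_left (by linarith)

end Separable

/-! ### Biseparable states, and non-convexity of the union of separable sets -/

section Biseparable

variable {n : ℕ} {d : Fin (n + 1) → ℕ}

theorem isState_of_separableAcross {S : Finset (Fin (n + 1))} {ρ : Op d}
    (h : SeparableAcross S ρ) : IsState ρ := by
  obtain ⟨m, q, τ, τ', hq, hq1, hτ, hτ', rfl⟩ := h
  refine ⟨Matrix.posSemidef_sum _ fun j _ =>
    (posSemidef_bipartiteProduct S (hτ j).1 (hτ' j).1).smul (hq j), ?_⟩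
  simp only [Matrix.trace_sum, Matrix.trace_smul, trace_bipartiteProduct, (hτ _).2, (hτ' _).2,
    mul_one, Complex.real_smul]
  rw [← Complex.ofReal_sum, hq1, Complex.ofReal_one]

theorem isState_of_mem_partitionSeparable {ρ : Op d} (h : ρ ∈ partitionSeparable d) :
    IsState ρ := by
  obtain ⟨S, -, -, hS⟩ := h
  exact isState_of_separableAcross hS

theorem re_trace_mul_nonneg_of_isBiseparable {W : Op d}
    (hW : ∀ σ ∈ partitionSeparable d, 0 ≤ (W * σ).trace.re) {ρ : Op d} (hρ : IsBiseparable ρ) :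
    0 ≤ (W * ρ).trace.re := by
  obtain ⟨m, q, σ, hq, -, hσ, rfl⟩ := hρ
  rw [Finset.mul_sum, Matrix.trace_sum, Complex.re_sum]
  refine Finset.sum_nonneg fun j _ => ?_
  rw [Matrix.mul_smul, Matrix.trace_smul, Complex.smul_re]
  exact mul_nonneg (hq j) (hW _ (hσ j))

theorem isBiseparable_half_add_half {σ τ : Op d} (hσ : σ ∈ partitionSeparable d)
    (hτ : τ ∈ partitionSeparable d) :
    IsBiseparable ((1 / 2 : ℝ) • σ + (1 / 2 : ℝ) • τ) := by
  refine ⟨2, ![1 / 2, 1 / 2], ![σ, τ], ?_, ?_, ?_, ?_⟩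
  · intro j; fin_cases j <;> norm_num
  · norm_num [Fin.sum_univ_two]
  · intro j; fin_cases j
    · exact hσ
    · exact hτ
  · simp [Fin.sum_univ_two]

theorem isState_half_add_half {κ : Type*} [Fintype κ] {σ τ : Matrix κ κ ℂ} (hσ : IsState σ)
    (hτ : IsState τ) : IsState ((1 / 2 : ℝ) • σ + (1 / 2 : ℝ) • τ) := by
  refine ⟨(hσ.1.smul (by norm_num)).add (hτ.1.smul (by norm_num)), ?_⟩
  rw [Matrix.trace_add, Matrix.trace_smul, Matrix.trace_smul, hσ.2, hτ.2]
  norm_num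

theorem exists_isPurification {ρ : Op d} (hρ : ρ.PosSemidef) :
    ∃ (m : ℕ) (ψ : Matrix (Config d) (Fin m) ℂ), IsPurification ψ ρ := by
  obtain ⟨g, hg⟩ := exists_eq_conjTranspose_mul_self hρ
  let e := Fintype.equivFin (Config d)
  refine ⟨_, gᴴ.submatrix id e.symm, ?_⟩
  rw [IsPurification, reduced, Matrix.conjTranspose_submatrix, Matrix.conjTranspose_conjTranspose,
    Matrix.submatrix_mul_equiv, hg]
  rfl

/-- The labels of the parties in `S`. -/
abbrev restrictConfig (S : Finset (Fin (n + 1))) (x : Config d) : ConfigOn d S := fun i => x i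

/-- The projector onto the line spanned by a unit vector `v`. -/
abbrev ketBra {κ : Type*} (v : κ → ℂ) : Matrix κ κ ℂ := Matrix.vecMulVec v (star v)

theorem ketBra_apply {κ : Type*} (v : κ → ℂ) (x y : κ) : ketBra v x y = v x * star (v y) := rfl

theorem isState_ketBra {κ : Type*} [Fintype κ] {v : κ → ℂ}
    (hv : ∑ x, Complex.normSq (v x) = 1) : IsState (ketBra v) := by
  refine ⟨Matrix.posSemidef_vecMulVec_self_star v, ?_⟩
  rw [Matrix.trace_vecMulVec, dotProduct]
  simp only [Pi.star_apply, Complex.star_def, Complex.mul_conj]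
  rw [← Complex.ofReal_sum, hv, Complex.ofReal_one]

theorem ketBra_mem_partitionSeparable {S : Finset (Fin (n + 1))} (hS : S.Nonempty)
    (hS' : S ≠ Finset.univ) {u : ConfigOn d S → ℂ} {w : ConfigOn d Sᶜ → ℂ}
    (hu : ∑ x, Complex.normSq (u x) = 1) (hw : ∑ x, Complex.normSq (w x) = 1) {v : Config d → ℂ}
    (hv : ∀ x, v x = u (fun i => x i) * w (fun i => x i)) :
    ketBra v ∈ partitionSeparable d := by
  refine ⟨S, hS, hS', 1, fun _ => 1, fun _ => ketBra u, fun _ => ketBra w, by simp, by simp,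
    fun _ => isState_ketBra hu, fun _ => isState_ketBra hw, ?_⟩
  ext x y
  simp only [Finset.univ_unique, Finset.sum_const, Finset.card_singleton, one_smul,
    bipartiteProduct, Matrix.of_apply, ketBra_apply, hv, star_mul']
  ring

/-- The vector `(|p⟩ + |q⟩) / √2`. -/
def twoPoint {κ : Type*} [DecidableEq κ] (p q : κ) (x : κ) : ℂ :=
  if x = p ∨ x = q then ((1 / √2 : ℝ) : ℂ) else 0

theorem normSq_one_div_sqrt_two : Complex.normSq ((1 / √2 : ℝ) : ℂ) = 1 / 2 := by
  rw [Complex.normSq_ofReal, ← sq, div_pow, Real.sq_sqrt zero_le_two, one_pow]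

theorem sum_normSq_twoPoint {κ : Type*} [Fintype κ] [DecidableEq κ] {p q : κ} (h : p ≠ q) :
    ∑ x, Complex.normSq (twoPoint p q x) = 1 := by
  have h1 : ∀ x, Complex.normSq (twoPoint p q x) = if x ∈ ({p, q} : Finset κ) then 1 / 2 else 0 := by
    intro x
    by_cases hx : x = p ∨ x = q
    · rw [twoPoint, if_pos hx, normSq_one_div_sqrt_two, if_pos (by simpa using hx)]
    · rw [twoPoint, if_neg hx, map_zero, if_neg (by simpa using hx)]
  simp only [h1, Finset.sum_ite_mem, Finset.univ_inter, Finset.sum_const, Finset.card_pair h]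
  norm_num

/-- Party k is in the same basis state in both terms and factors out. The party j keeps the two
labels of the others distinct, so their superposition is normalised. -/
theorem ketBra_twoPoint_mem_partitionSeparable {p q : Config d} {k j : Fin (n + 1)}
    (hk : p k = q k) (hj : p j ≠ q j) : ketBra (twoPoint p q) ∈ partitionSeparable d := by
  have hjk : j ≠ k := fun h => hj (h ▸ hk)
  have hjS : j ∈ ({k} : Finset (Fin (n + 1)))ᶜ := by simpa using hjk
  refine ketBra_mem_partitionSeparable (S := {k}) (Finset.singleton_nonempty k) ?_
    (u := fun y => if y ⟨k, Finset.mem_singleton_self k⟩ = p k then 1 else 0)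
    (w := twoPoint (fun i => p i) (fun i => q i)) ?_ (sum_normSq_twoPoint ?_) ?_
  · intro h
    rw [h] at hjS
    simp at hjS
  · rw [Finset.sum_eq_single (restrictConfig {k} p)]
    · rw [if_pos rfl, map_one]
    · intro y _ hy
      rw [if_neg, map_zero]
      intro h
      refine hy (funext fun i => ?_)
      obtain ⟨i, hi⟩ := i
      obtain rfl := Finset.mem_singleton.1 hi
      exact h
    · simp
  · intro h
    exact hj (congrFun h ⟨j, hjS⟩)
  · intro x
    have hext : ∀ r : Config d, (x = r ↔ x k = r k ∧
        restrictConfig {k}ᶜ x = restrictConfig {k}ᶜ r) := by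
      intro r
      refine ⟨fun h => by simp [h], fun ⟨h1, h2⟩ => funext fun i => ?_⟩
      by_cases hi : i = k
      · rw [hi, h1]
      · exact congrFun h2 ⟨i, by simpa using hi⟩
    change _ = (if x k = p k then 1 else 0) *
      twoPoint (restrictConfig {k}ᶜ p) (restrictConfig {k}ᶜ q) (restrictConfig {k}ᶜ x)
    simp only [twoPoint, hext p, hext q, ← hk, ← and_or_left]
    by_cases h : x k = p k <;> simp only [h, true_and, false_and, if_true, if_false, one_mul,
      zero_mul]

theorem apply_eq_zero_of_posSemidef {κ : Type*} [Fintype κ] [DecidableEq κ] {M : Matrix κ κ ℂ}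
    (hM : M.PosSemidef) {x : κ} (hx : M x x = 0) (y : κ) : M x y = 0 ∧ M y x = 0 := by
  obtain ⟨g, rfl⟩ := exists_eq_conjTranspose_mul_self hM
  have h : ∀ k, g k x = 0 := by
    have h1 : ∑ k, Complex.normSq (g k x) = 0 := by
      have h2 := congrArg Complex.re hx
      simpa [Matrix.mul_apply, ← Complex.normSq_eq_conj_mul_self] using h2
    intro k
    exact Complex.normSq_eq_zero.1 ((Finset.sum_eq_zero_iff_of_nonneg fun k _ =>
      Complex.normSq_nonneg _).1 h1 k (Finset.mem_univ k))
  simp [Matrix.mul_apply, h]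

/-- A matrix element of a separable state vanishes if the population of the configuration that
combines its two labels vanishes. -/
theorem SeparableAcross.apply_eq_zero {S : Finset (Fin (n + 1))} {ρ : Op d}
    (hρ : SeparableAcross S ρ) {x y z : Config d} (hzS : ∀ i ∈ S, z i = y i)
    (hzS' : ∀ i ∉ S, z i = x i) (hz : ρ z z = 0) : ρ x y = 0 := by
  obtain ⟨m, q, τ, τ', hq, -, hτ, hτ', rfl⟩ := hρ
  have h1 : ∀ j, 0 ≤ (q j • bipartiteProduct S (τ j) (τ' j)) z z := fun j =>
    ((posSemidef_bipartiteProduct S (hτ j).1 (hτ' j).1).smul (hq j)).diag_nonneg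
  rw [Matrix.sum_apply, Finset.sum_eq_zero_iff_of_nonneg fun j _ => h1 j] at hz
  rw [Matrix.sum_apply]
  refine Finset.sum_eq_zero fun j hj => ?_
  have h2 := hz j hj
  rw [Matrix.smul_apply, smul_eq_zero] at h2 ⊢
  refine h2.imp_right fun h3 => ?_
  simp only [bipartiteProduct, Matrix.of_apply] at h3 ⊢
  change τ j (restrictConfig S z) (restrictConfig S z) *
    τ' j (restrictConfig Sᶜ z) (restrictConfig Sᶜ z) = 0 at h3
  -- The vanishing product is τ at y times τ' at x, both on the diagonal. Whichever factor is zero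
  -- kills its whole row and column, hence the matrix element at (x, y).
  rw [show restrictConfig S z = restrictConfig S y from funext fun i => hzS i i.2,
    show restrictConfig Sᶜ z = restrictConfig Sᶜ x from
      funext fun i => hzS' i (Finset.mem_compl.1 i.2), mul_eq_zero] at h3
  rcases h3 with h3 | h3
  · rw [(apply_eq_zero_of_posSemidef (hτ j).1 h3 _).2, zero_mul]
  · rw [(apply_eq_zero_of_posSemidef (hτ' j).1 h3 _).1, mul_zero]

theorem re_ketBra_twoPoint_nonneg {κ : Type*} [DecidableEq κ] (p q x y : κ) :
    0 ≤ (ketBra (twoPoint p q) x y).re := by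
  simp only [ketBra_apply, twoPoint]
  split_ifs <;> simp
  positivity

/-- The counterexample is the midpoint of two states (|0…0⟩ + |q k⟩)/√2, where q k has 0 at party k
and 1 elsewhere, for two parties k other than Alice. Both coherences survive in the midpoint, while
every cut requires one of them to vanish. -/
theorem not_convex_partitionSeparable (hn : 2 ≤ n) (hd : ∀ i, 2 ≤ d i) :
    ¬ Convex ℝ (partitionSeparable d) := by
  intro hconv
  let p : Config d := fun i => ⟨0, by have := hd i; omega⟩
  let o : Config d := fun i => ⟨1, by have := hd i; omega⟩
  have hpo : ∀ i, o i ≠ p i := fun i h => by simpa [o, p] using congrArg Fin.val h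
  let q : Fin (n + 1) → Config d := fun k => Function.update o k (p k)
  have hqk : ∀ k, q k k = p k := fun k => Function.update_self ..
  have hq : ∀ {k i}, i ≠ k → q k i = o i := fun h => Function.update_of_ne h ..
  let k₁ : Fin (n + 1) := ⟨1, by omega⟩
  let k₂ : Fin (n + 1) := ⟨2, by omega⟩
  have h12 : k₁ ≠ k₂ := by simp [k₁, k₂]
  have h01 : (0 : Fin (n + 1)) ≠ k₁ := fun h => by simpa [k₁] using congrArg Fin.val h
  have h02 : (0 : Fin (n + 1)) ≠ k₂ := fun h => by simpa [k₂] using congrArg Fin.val h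
  have hmem : ∀ k, 0 ≠ k → ketBra (twoPoint p (q k)) ∈ partitionSeparable d := fun k hk =>
    ketBra_twoPoint_mem_partitionSeparable (hqk k).symm
      (by rw [hq hk]; exact (hpo 0).symm)
  obtain ⟨S, hS, hS', hsep⟩ := hconv (hmem k₁ h01) (hmem k₂ h02)
    (a := 1 / 2) (b := 1 / 2) (by norm_num) (by norm_num) (by norm_num)
  set ρ : Op d := (1 / 2 : ℝ) • ketBra (twoPoint p (q k₁)) + (1 / 2 : ℝ) • ketBra (twoPoint p (q k₂))
    with hρdef
  have hre : ∀ x y, (ρ x y).re = 1 / 2 * (ketBra (twoPoint p (q k₁)) x y).re +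
      1 / 2 * (ketBra (twoPoint p (q k₂)) x y).re := fun x y => by
    simp only [hρdef, Matrix.add_apply, Matrix.smul_apply, Complex.add_re, Complex.smul_re,
      smul_eq_mul]
  have hone : ∀ k x y, (x = p ∨ x = q k) → (y = p ∨ y = q k) →
      (ketBra (twoPoint p (q k)) x y).re = 1 / 2 := by
    intro k x y hx hy
    rw [ketBra_apply, twoPoint, twoPoint, if_pos hx, if_pos hy,
      Complex.star_def, Complex.mul_conj, normSq_one_div_sqrt_two, Complex.ofReal_re]
  -- All entries have nonnegative real part, so the two components cannot cancel.
  have hne : ∀ k, (k = k₁ ∨ k = k₂) → ∀ x y, (x = p ∨ x = q k) → (y = p ∨ y = q k) →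
      ρ x y ≠ 0 := by
    intro k hk x y hx hy h0
    have h1 := hre x y
    have h2 := hone k x y hx hy
    have h3 := re_ketBra_twoPoint_nonneg p (q k₁) x y
    have h4 := re_ketBra_twoPoint_nonneg p (q k₂) x y
    rw [h0, Complex.zero_re] at h1
    rcases hk with rfl | rfl <;> linarith
  -- Among the populated labels only p gives Alice the value 0.
  have hzero : ∀ z, z ≠ p → z 0 = p 0 → ρ z z = 0 := by
    intro z hz hz0
    have h1 : ∀ k, 0 ≠ k → twoPoint p (q k) z = 0 := fun k hk => by
      rw [twoPoint, if_neg]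
      rintro (h | h)
      · exact hz h
      · rw [h, hq hk] at hz0
        exact hpo 0 hz0
    simp [hρdef, ketBra_apply, h1 k₁ h01, h1 k₂ h02]
  -- T is the side of the cut without Alice. It cannot equal both {k₁} and {k₂}, so for one k it
  -- contains a party where q k and p differ. The hybrid of q k on T and p off T is then an
  -- unpopulated label.
  have hchoice : ∀ T : Finset (Fin (n + 1)), T.Nonempty → 0 ∉ T →
      ∃ k, (k = k₁ ∨ k = k₂) ∧ ∀ z : Config d, (∀ i ∈ T, z i = q k i) →
        (∀ i ∉ T, z i = p i) → ρ z z = 0 := by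
    intro T hT h0
    obtain ⟨k, hk, t, htT, htk⟩ : ∃ k, (k = k₁ ∨ k = k₂) ∧ ∃ t ∈ T, t ≠ k := by
      obtain ⟨t, ht⟩ := hT
      by_cases h : t = k₁
      · exact ⟨k₂, Or.inr rfl, t, ht, h ▸ h12⟩
      · exact ⟨k₁, Or.inl rfl, t, ht, h⟩
    refine ⟨k, hk, fun z hz hz' => hzero z (fun h => ?_) (hz' 0 h0)⟩
    have h1 := hz t htT
    rw [h, hq htk] at h1
    exact hpo t h1.symm
  by_cases h0 : 0 ∈ S
  · obtain ⟨k, hk, hz⟩ := hchoice Sᶜ (by rwa [Finset.nonempty_iff_ne_empty, ne_eq,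
      Finset.compl_eq_empty_iff]) (by simpa using h0)
    refine hne k hk _ _ (Or.inr rfl) (Or.inl rfl) (hsep.apply_eq_zero (x := q k) (y := p)
      (z := S.piecewise p (q k)) (fun i hi => S.piecewise_eq_of_mem _ _ hi)
      (fun i hi => S.piecewise_eq_of_notMem _ _ hi) (hz _ (fun i hi => ?_) fun i hi => ?_))
    · exact S.piecewise_eq_of_notMem _ _ (by simpa using hi)
    · exact S.piecewise_eq_of_mem _ _ (by simpa using hi)
  · obtain ⟨k, hk, hz⟩ := hchoice S hS h0
    exact hne k hk _ _ (Or.inl rfl) (Or.inr rfl) (hsep.apply_eq_zero (x := p) (y := q k)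
      (z := S.piecewise (q k) p) (fun i hi => S.piecewise_eq_of_mem _ _ hi)
      (fun i hi => S.piecewise_eq_of_notMem _ _ hi)
      (hz _ (fun i hi => S.piecewise_eq_of_mem _ _ hi)
        fun i hi => S.piecewise_eq_of_notMem _ _ hi))

end Biseparable

/-! ### Quantities determined by the measured statistics -/

section Statistics

variable {n : ℕ} {d : Fin (n + 1) → ℕ}

theorem localProduct_diagonal (f : (i : Fin (n + 1)) → Fin (d i) → ℂ) :
    localProduct (fun i => Matrix.diagonal (f i)) = Matrix.diagonal fun x => ∏ i, f i (x i) := by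
  ext x y
  simp only [localProduct, Matrix.of_apply, Matrix.diagonal_apply]
  by_cases h : x = y
  · subst h; simp
  · obtain ⟨i, hi⟩ := Function.ne_iff.1 h
    rw [if_neg h]
    exact Finset.prod_eq_zero (Finset.mem_univ i) (if_neg hi)

/-- Expectation values of products of linear combinations of the effects are determined by the
statistics. -/
theorem re_trace_localProduct_sum_smul_mul (P : Protocol d) (ρ : Op d)
    (x : (i : Fin (n + 1)) → Fin (P.settings i))
    (s : (i : Fin (n + 1)) → Fin (P.outcomes i (x i)) → ℝ) :
    (localProduct (fun i => ∑ c, s i c • (P.povm i (x i)).effect c) * ρ).trace.re =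
      ∑ c : (i : Fin (n + 1)) → Fin (P.outcomes i (x i)), (∏ i, s i (c i)) *
        statistics P ρ x c := by
  have h : localProduct (fun i => ∑ c, s i c • (P.povm i (x i)).effect c) =
      ∑ c : (i : Fin (n + 1)) → Fin (P.outcomes i (x i)), (∏ i, s i (c i)) •
        localProduct fun i => (P.povm i (x i)).effect (c i) := by
    ext y z
    simp only [localProduct, Matrix.of_apply, Matrix.sum_apply, Matrix.smul_apply]
    rw [Finset.prod_univ_sum, Fintype.piFinset_univ]
    refine Finset.sum_congr rfl fun c _ => ?_
    simp only [Complex.real_smul, Finset.prod_mul_distrib, Complex.ofReal_prod]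
  rw [h, Finset.sum_mul, Matrix.trace_sum, Complex.re_sum]
  refine Finset.sum_congr rfl fun c _ => ?_
  rw [Matrix.smul_mul, Matrix.trace_smul, Complex.smul_re, smul_eq_mul, statistics]

theorem keyDist_eq_of_statistics_eq {P : Protocol d} {ρ ρ' : Op d}
    (h : statistics P ρ' = statistics P ρ) : keyDist P ρ' = keyDist P ρ := by
  ext i ⟨a, b⟩
  -- Indicators select the outcomes of Alice and Bob i. The constant 1 for every other party sums
  -- its effects to the identity, which is marginalisation.
  let s : (j : Fin (n + 1)) → Fin (keyOutcomes P j) → ℝ :=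
    Function.update (Function.update (fun _ _ => 1) 0 (Pi.single a 1)) i.succ (Pi.single b 1)
  have hs : (Function.update (Function.update
      (fun j => (1 : Matrix (Fin (d j)) (Fin (d j)) ℂ)) 0 (keyEffect P 0 a))
      i.succ (keyEffect P i.succ b)) = fun j => ∑ c, s j c • (P.povm j (P.key j)).effect c := by
    funext j
    by_cases hj : j = i.succ
    · subst hj
      simp [s, Pi.single_apply]
    · by_cases hj0 : j = 0
      · subst hj0
        simp [s, Pi.single_apply, Function.update_of_ne hj]
      · simp [s, Function.update_of_ne hj, Function.update_of_ne hj0,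
          (P.povm j (P.key j)).sum_eq_one]
  rw [keyDist, keyDist, hs]
  exact (re_trace_localProduct_sum_smul_mul P ρ' P.key s).trans
    (h ▸ (re_trace_localProduct_sum_smul_mul P ρ P.key s).symm)

end Statistics

/-! ### Bit-flip symmetry and the entropies of N-BB84 -/

section Qubits

variable {n : ℕ}

/-- Product basis labels of `n + 1` qubits. -/
abbrev Bits (n : ℕ) : Type := Config (fun _ : Fin (n + 1) => 2)

/-- Flipping all bits. -/
def flipBits (n : ℕ) : Bits n ≃ Bits n :=
  Equiv.piCongrRight fun _ => Equiv.addRight 1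

theorem flipBits_apply (x : Bits n) (i : Fin (n + 1)) : flipBits n x i = x i + 1 := rfl

/-- The operator `X ⊗ ⋯ ⊗ X`. -/
def flipOp (n : ℕ) : Op (fun _ : Fin (n + 1) => 2) := localProduct fun _ => !![0, 1; 1, 0]

theorem flipOp_apply (x y : Bits n) : flipOp n x y = if y = flipBits n x then 1 else 0 := by
  have h : ∀ a b : Fin 2, (!![0, 1; 1, 0] : Matrix (Fin 2) (Fin 2) ℂ) a b =
      if b = a + 1 then 1 else 0 := by
    intro a b
    fin_cases a <;> fin_cases b <;> simp
  simp only [flipOp, localProduct, Matrix.of_apply, h, Finset.prod_boole, Finset.mem_univ,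
    true_implies, funext_iff, flipBits_apply]

theorem flipOp_mul_apply {m : Type*} (M : Matrix (Bits n) m ℂ) (x : Bits n) (e : m) :
    (flipOp n * M) x e = M (flipBits n x) e := by
  simp [Matrix.mul_apply, flipOp_apply]

/-- Writing Pauli X as a signed sum of effects makes the expectation value of X ⊗ ⋯ ⊗ X a function
of the X-basis statistics. -/
theorem sum_smul_xPOVM_effect :
    ∑ c : Fin 2, ((-1) ^ (c : ℕ) : ℝ) • xPOVM.effect c = !![0, 1; 1, 0] := by
  have h : ((√2 : ℝ) : ℂ) * ((√2 : ℝ) : ℂ) = 2 := by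
    rw [← Complex.ofReal_mul, Real.mul_self_sqrt (by norm_num)]; norm_num
  have h0 : ((√2 : ℝ) : ℂ) ≠ 0 := by
    intro h1; rw [h1] at h; norm_num at h
  ext i j
  fin_cases i <;> fin_cases j <;> simp [xPOVM, Matrix.vecMulVec, xVec] <;> field_simp <;>
    first | ring1 | linear_combination -h

theorem re_trace_flipOp_mul_eq_of_statistics_eq {ρ ρ' : Op (fun _ : Fin (n + 1) => 2)}
    (h : statistics (nBB84 n) ρ' = statistics (nBB84 n) ρ) :
    (flipOp n * ρ').trace.re = (flipOp n * ρ).trace.re := by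
  have h1 := fun σ => re_trace_localProduct_sum_smul_mul (nBB84 n) σ (fun _ => (1 : Fin 2))
    fun _ c => (-1) ^ (c : ℕ)
  have h2 : (fun i : Fin (n + 1) => ∑ c : Fin ((nBB84 n).outcomes i (1 : Fin 2)),
      ((-1) ^ (c : ℕ) : ℝ) • ((nBB84 n).povm i (1 : Fin 2)).effect c) =
        fun _ => !![0, 1; 1, 0] := by
    funext i
    exact sum_smul_xPOVM_effect
  rw [h2] at h1
  exact (h1 ρ').trans (h ▸ (h1 ρ).symm)

/-- A vector on which `X ⊗ ⋯ ⊗ X` has expectation value `1` is invariant under bit flips. -/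
theorem apply_flipBits_eq {m : ℕ} {ψ : Matrix (Bits n) (Fin m) ℂ}
    (htr : (ψ * ψᴴ).trace.re = 1) (hX : (flipOp n * (ψ * ψᴴ)).trace.re = 1) (x : Bits n)
    (e : Fin m) : ψ (flipBits n x) e = ψ x e := by
  have h1 : ∑ x, ∑ e, Complex.normSq (ψ x e) = 1 := by
    rw [← htr, Matrix.trace, Complex.re_sum]
    refine Finset.sum_congr rfl fun x _ => ?_
    simp [Matrix.mul_apply, Complex.mul_conj]
  have h2 : ∑ x, ∑ e, Complex.normSq (ψ (flipBits n x) e) = 1 := by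
    rw [← h1]
    exact (flipBits n).sum_comp fun x => ∑ e, Complex.normSq (ψ x e)
  have h3 : ∑ x, ∑ e, (ψ (flipBits n x) e * star (ψ x e)).re = 1 := by
    rw [← hX, ← Matrix.mul_assoc, Matrix.trace, Complex.re_sum]
    refine Finset.sum_congr rfl fun x _ => ?_
    rw [Matrix.diag_apply, Matrix.mul_apply, Complex.re_sum]
    refine Finset.sum_congr rfl fun e _ => ?_
    rw [flipOp_mul_apply, Matrix.conjTranspose_apply]
  -- The squared distance between ψ and its flip is 1 + 1 - 2 · 1.
  have h4 : ∑ x, ∑ e, Complex.normSq (ψ (flipBits n x) e - ψ x e) = 0 := by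
    have h5 : ∀ x e, Complex.normSq (ψ (flipBits n x) e - ψ x e) =
        Complex.normSq (ψ (flipBits n x) e) + Complex.normSq (ψ x e) -
          2 * (ψ (flipBits n x) e * star (ψ x e)).re := fun x e => Complex.normSq_sub _ _
    simp only [h5, Finset.sum_sub_distrib, Finset.sum_add_distrib, ← Finset.mul_sum, h1, h2, h3]
    norm_num
  have h5 := (Finset.sum_eq_zero_iff_of_nonneg fun x _ =>
    Finset.sum_nonneg fun e _ => Complex.normSq_nonneg _).1 h4 x (Finset.mem_univ x)
  have h6 := (Finset.sum_eq_zero_iff_of_nonneg fun e _ =>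
    Complex.normSq_nonneg _).1 h5 e (Finset.mem_univ e)
  exact sub_eq_zero.1 (Complex.normSq_eq_zero.1 h6)

theorem zPOVM_effect (a : Fin 2) : zPOVM.effect a = Matrix.diagonal (Pi.single a 1) := by
  ext i j
  fin_cases a <;> fin_cases i <;> fin_cases j <;> simp [zPOVM, Matrix.vecMulVec]

theorem localProduct_update_zPOVM (k : Fin (n + 1)) (a : Fin 2) :
    localProduct (d := fun _ => 2) (Function.update (fun _ => 1) k (zPOVM.effect a)) =
      Matrix.diagonal fun x => if x k = a then 1 else 0 := by
  have h : Function.update (fun _ : Fin (n + 1) => (1 : Matrix (Fin 2) (Fin 2) ℂ)) k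
      (zPOVM.effect a) = fun i => Matrix.diagonal
        (Function.update (fun _ _ => (1 : ℂ)) k (Pi.single a 1 : Fin 2 → ℂ) i) := by
    funext i
    by_cases hi : i = k
    · subst hi; simp [zPOVM_effect]
    · simp [Function.update_of_ne hi]
  rw [h, localProduct_diagonal]
  congr 1
  funext x
  rw [Finset.prod_eq_single k]
  · simp [Pi.single_apply]
  · intro i _ hi
    rw [Function.update_of_ne hi]
  · simp

theorem keyDist_nBB84 (ρ : Op (fun _ : Fin (n + 1) => 2)) (i : Fin n) (a b : Fin 2) :
    keyDist (nBB84 n) ρ i (a, b) =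
      ∑ x, if x 0 = a ∧ x i.succ = b then (ρ x x).re else 0 := by
  have h : localProduct (d := fun _ : Fin (n + 1) => 2) (Function.update (Function.update
      (fun _ => 1) 0 (zPOVM.effect a)) i.succ (zPOVM.effect b)) =
      Matrix.diagonal fun x => if x 0 = a ∧ x i.succ = b then 1 else 0 := by
    rw [show (Function.update (Function.update (fun _ : Fin (n + 1) =>
      (1 : Matrix (Fin 2) (Fin 2) ℂ)) 0 (zPOVM.effect a)) i.succ (zPOVM.effect b)) = fun j =>
        Function.update (fun _ => 1) 0 (zPOVM.effect a) j *
          Function.update (fun _ => 1) i.succ (zPOVM.effect b) j by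
      funext j
      by_cases hj : j = i.succ
      · subst hj
        simp
      · simp [Function.update_of_ne hj], ← localProduct_mul (d := fun _ => 2),
      localProduct_update_zPOVM, localProduct_update_zPOVM, Matrix.diagonal_mul_diagonal]
    congr 1
    funext x
    by_cases h0 : x 0 = a <;> by_cases h1 : x i.succ = b <;> simp [h0, h1]
  change (localProduct (d := fun _ : Fin (n + 1) => 2) (Function.update (Function.update
      (fun _ => 1) 0 (zPOVM.effect a)) i.succ (zPOVM.effect b)) * ρ).trace.re = _
  rw [h, Matrix.trace, Complex.re_sum]
  refine Finset.sum_congr rfl fun x _ => ?_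
  rw [Matrix.diag_apply, Matrix.diagonal_mul]
  split_ifs <;> simp

theorem eveState_nBB84_apply {m : ℕ} (ψ : Matrix (Bits n) (Fin m) ℂ) (a : Fin 2)
    (e e' : Fin m) : eveState (nBB84 n) ψ a e e' =
      ∑ x, if x 0 = a then star (ψ x e') * ψ x e else 0 := by
  change (ψᴴ * localProduct (d := fun _ : Fin (n + 1) => 2)
    (Function.update (fun _ => 1) 0 (zPOVM.effect a)) * ψ) e' e = _
  rw [localProduct_update_zPOVM, Matrix.mul_apply]
  refine Finset.sum_congr rfl fun x _ => ?_
  rw [Matrix.mul_diagonal, Matrix.conjTranspose_apply]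
  split_ifs <;> simp

/-- Eigenvalue by eigenvalue, η(2x) = 2 η(x) - 2 x log 2 for η(x) = -x log x. It is used with Eve's
total state being twice either conditional state, where the trace term provides the one bit. -/
theorem spectralSum_negMulLog_two_smul {κ : Type*} [Fintype κ] [DecidableEq κ]
    {M : Matrix κ κ ℂ} (hM : M.IsHermitian) :
    spectralSum Real.negMulLog ((2 : ℝ) • M) =
      2 * spectralSum Real.negMulLog M - 2 * Real.log 2 * M.trace.re := by
  have hM2 : ((2 : ℝ) • M).IsHermitian := by
    rw [Matrix.IsHermitian, Matrix.conjTranspose_smul, hM]; simp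
  have h : cfc (fun x => Real.negMulLog ((2 : ℝ) • x)) M = cfc Real.negMulLog ((2 : ℝ) • M) :=
    cfc_comp_smul (2 : ℝ) Real.negMulLog M Real.continuous_negMulLog.continuousOn hM
  rw [← re_trace_cfc _ hM2, ← h, re_trace_cfc _ hM,
    spectralSum_eq_sum_eigenvalues _ hM, spectralSum_eq_sum_eigenvalues _ hM,
    hM.trace_eq_sum_eigenvalues, Complex.re_sum, Finset.mul_sum, Finset.mul_sum,
    ← Finset.sum_sub_distrib]
  refine Finset.sum_congr rfl fun i _ => ?_
  rw [smul_eq_mul, Real.negMulLog_mul]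
  simp only [Real.negMulLog, Complex.coe_algebraMap, Complex.ofReal_re]
  ring

/-- The outcome of Alice is uniform and independent of Eve if the state is invariant under bit
flips. -/
theorem condEntropyEve_nBB84_eq_one {m : ℕ} {ψ : Matrix (Bits n) (Fin m) ℂ}
    (htr : (ψ * ψᴴ).trace.re = 1) (hX : (flipOp n * (ψ * ψᴴ)).trace.re = 1) :
    condEntropyEve (nBB84 n) ψ = 1 := by
  have hflip := apply_flipBits_eq htr hX
  let E : Fin 2 → Matrix (Fin m) (Fin m) ℂ := eveState (nBB84 n) ψ
  -- The flip exchanges Alice's two outcomes and leaves ψ unchanged.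
  have hE : E 1 = E 0 := by
    ext e e'
    simp only [E]
    rw [eveState_nBB84_apply, eveState_nBB84_apply, ← (flipBits n).sum_comp]
    refine Finset.sum_congr rfl fun x _ => ?_
    have h1 : ∀ a : Fin 2, a + 1 = 1 ↔ a = 0 := by decide
    simp only [hflip, flipBits_apply, h1]
  have hH : (E 0).IsHermitian := (posSemidef_eveState (nBB84 n) ψ _).isHermitian
  have hsum : E 0 + E 1 = (ψᴴ * ψ)ᵀ := by
    have h1 : ∑ a : Fin 2, aliceEffect (nBB84 n) a = 1 := sum_localProduct_keyEffect (nBB84 n) 0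
    rw [Fin.sum_univ_two] at h1
    have h2 : ψᴴ * ψ = ψᴴ * (aliceEffect (nBB84 n) (0 : Fin 2) + aliceEffect (nBB84 n)
        (1 : Fin 2)) * ψ := by rw [h1, Matrix.mul_one]
    rw [h2, Matrix.mul_add, Matrix.add_mul, Matrix.transpose_add]
    rfl
  have htwo : E 0 + E 1 = (2 : ℝ) • E 0 := by rw [hE, two_smul]
  have htrE : (E 0).trace.re = 1 / 2 := by
    have h1 := congrArg (fun M => M.trace.re) (htwo.symm.trans hsum)
    simp only [Matrix.trace_smul, Matrix.trace_transpose, Matrix.trace_mul_comm ψᴴ, htr,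
      Complex.smul_re, smul_eq_mul] at h1
    linarith
  rw [condEntropyEve_eq_spectralSum]
  change (∑ a : Fin 2, spectralSum Real.negMulLog (E a) -
    spectralSum Real.negMulLog (∑ a : Fin 2, E a)) / Real.log 2 = 1
  rw [Fin.sum_univ_two, Fin.sum_univ_two, htwo, hE, spectralSum_negMulLog_two_smul hH, htrE]
  have : Real.log 2 ≠ 0 := (Real.log_pos one_lt_two).ne'
  field_simp
  ring

/-- For a symmetric distribution the conditional entropy is the binary entropy of the error rate t =
2 p(0,1), which equals one bit only at t = 1/2. -/
theorem binary_condEntropy_lt_one {p : Fin 2 × Fin 2 → ℝ} (h00 : p (1, 1) = p (0, 0))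
    (h01 : p (1, 0) = p (0, 1)) (hsum : p (0, 0) + p (0, 1) = 1 / 2) (hne : p (0, 1) ≠ 1 / 4) :
    shannonEntropy p - shannonEntropy (fun b => ∑ a, p (a, b)) < 1 := by
  have hlog := Real.log_pos one_lt_two
  rw [shannonEntropy, shannonEntropy, ← sub_div, div_lt_one hlog]
  simp only [Fintype.sum_prod_type, Fin.sum_univ_two, h00, h01]
  rw [add_comm (p (0, 1)) (p (0, 0)), hsum]
  set t := 2 * p (0, 1) with ht
  have h1 : p (0, 1) = 1 / 2 * t := by rw [ht]; ring
  have h2 : p (0, 0) = 1 / 2 * (1 - t) := by rw [ht]; linarith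
  have h3 : Real.binEntropy t < Real.log 2 := Real.binEntropy_lt_log_two.2 fun h =>
    hne (by rw [h1, h]; norm_num)
  rw [Real.binEntropy_eq_negMulLog_add_negMulLog_one_sub] at h3
  have h4 : Real.negMulLog (1 / 2) = 1 / 2 * Real.log 2 := by
    rw [Real.negMulLog, one_div, Real.log_inv]; ring
  rw [h1, h2, Real.negMulLog_mul, Real.negMulLog_mul, h4]
  linarith

end Qubits

/-! ### A biseparable state with positive key rate -/

section Witness

variable {n : ℕ}

/-- The GHZ state of all qubits but the `k`-th, together with the state `|+⟩` of the `k`-th. -/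
def ghzPlus (k : Fin (n + 1)) (x : Bits n) : ℂ :=
  if ∀ j, j ≠ k → x j = x 0 then 1 / 2 else 0

theorem ghzPlus_flipBits (k : Fin (n + 1)) (x : Bits n) :
    ghzPlus k (flipBits n x) = ghzPlus k x := by
  simp only [ghzPlus, flipBits_apply, add_left_inj]

/-- The amplitude 1/2 is the product of 1/√2 from |+⟩ and 1/√2 from GHZ. Alice's bit is the
reference value in `ghzPlus`, so she must belong to the GHZ part. -/
theorem ketBra_ghzPlus_mem_partitionSeparable {k : Fin (n + 1)} (hk : k ≠ 0) :
    ketBra (ghzPlus k) ∈ partitionSeparable (fun _ : Fin (n + 1) => 2) := by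
  have h0 : (0 : Fin (n + 1)) ∈ ({k} : Finset (Fin (n + 1)))ᶜ := by simpa using hk.symm
  refine ketBra_mem_partitionSeparable (S := {k}) (Finset.singleton_nonempty k) ?_
    (u := fun _ => ((1 / √2 : ℝ) : ℂ)) (w := twoPoint (fun _ => 0) (fun _ => 1)) ?_
    (sum_normSq_twoPoint fun h => zero_ne_one (congrFun h ⟨0, h0⟩)) fun x => ?_
  · intro h
    rw [h] at h0
    simp at h0
  · simp only [normSq_one_div_sqrt_two, Finset.sum_const, Finset.card_univ]
    rw [Fintype.card_pi]
    simp
  · have h1 : (∀ j, j ≠ k → x j = x 0) ↔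
        restrictConfig {k}ᶜ x = (fun _ => 0) ∨ restrictConfig {k}ᶜ x = fun _ => 1 := by
      have h2 : ∀ c : Fin 2, restrictConfig {k}ᶜ x = (fun _ => c) ↔ ∀ j, j ≠ k → x j = c := by
        intro c
        refine ⟨fun h j hj => congrFun h ⟨j, by simpa using hj⟩, fun h => funext fun j => ?_⟩
        exact h j fun hj => Finset.mem_compl.1 j.2 (Finset.mem_singleton.2 hj)
      rw [h2, h2]
      constructor
      · intro h
        have h3 : ∀ a : Fin 2, a = 0 ∨ a = 1 := by decide
        exact (h3 (x 0)).imp (fun h4 j hj => (h j hj).trans h4) fun h4 j hj => (h j hj).trans h4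
      · rintro (h | h) j hj <;> rw [h j hj, h 0 hk.symm]
    change _ = ((1 / √2 : ℝ) : ℂ) * twoPoint (fun _ => 0) (fun _ => 1) (restrictConfig {k}ᶜ x)
    rw [ghzPlus, twoPoint]
    simp only [h1]
    split_ifs
    · rw [← Complex.ofReal_mul, ← sq, div_pow, Real.sq_sqrt zero_le_two]
      norm_num
    · rw [mul_zero]

/-- An equal mixture of two states in which one of two parties is not entangled with the others. -/
def ghzMixture (k l : Fin (n + 1)) : Op (fun _ : Fin (n + 1) => 2) :=
  (1 / 2 : ℝ) • ketBra (ghzPlus k) + (1 / 2 : ℝ) • ketBra (ghzPlus l)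

theorem isState_ghzMixture {k l : Fin (n + 1)} (hk : k ≠ 0) (hl : l ≠ 0) :
    IsState (ghzMixture k l) :=
  isState_half_add_half
    (isState_of_mem_partitionSeparable (ketBra_ghzPlus_mem_partitionSeparable hk))
    (isState_of_mem_partitionSeparable (ketBra_ghzPlus_mem_partitionSeparable hl))

theorem ghzMixture_flipBits_left (k l : Fin (n + 1)) (x y : Bits n) :
    ghzMixture k l (flipBits n x) y = ghzMixture k l x y := by
  simp only [ghzMixture, Matrix.add_apply, Matrix.smul_apply, ketBra_apply, ghzPlus_flipBits]

theorem ghzMixture_flipBits_right (k l : Fin (n + 1)) (x y : Bits n) :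
    ghzMixture k l x (flipBits n y) = ghzMixture k l x y := by
  simp only [ghzMixture, Matrix.add_apply, Matrix.smul_apply, ketBra_apply, ghzPlus_flipBits]

theorem flipOp_mul_ghzMixture (k l : Fin (n + 1)) :
    flipOp n * ghzMixture k l = ghzMixture k l := by
  ext x y
  rw [flipOp_mul_apply, ghzMixture_flipBits_left]

theorem re_ghzMixture_diag (k l : Fin (n + 1)) (x : Bits n) : (ghzMixture k l x x).re =
    1 / 2 * Complex.normSq (ghzPlus k x) + 1 / 2 * Complex.normSq (ghzPlus l x) := by
  simp only [ghzMixture, Matrix.add_apply, Matrix.smul_apply, ketBra_apply, Complex.star_def,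
    Complex.mul_conj, Complex.add_re, Complex.smul_re, Complex.ofReal_re, smul_eq_mul]

/-- Alice and a Bob inside the GHZ part never disagree. For the Bob in |+⟩, a single label has Alice
at 0 and him at 1, with weight 1/4. -/
theorem sum_normSq_ghzPlus_le (k : Fin (n + 1)) (i : Fin n) :
    ∑ x : Bits n, (if x 0 = 0 ∧ x i.succ = 1 then Complex.normSq (ghzPlus k x) else 0) ≤
      if i.succ = k then 1 / 4 else 0 := by
  have h : ∀ x : Bits n, (if x 0 = 0 ∧ x i.succ = 1 then Complex.normSq (ghzPlus k x) else 0) ≤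
      if x = Pi.single i.succ 1 then (if i.succ = k then 1 / 4 else 0) else 0 := by
    intro x
    by_cases hx : x 0 = 0 ∧ x i.succ = 1
    · rw [if_pos hx, ghzPlus]
      by_cases hg : ∀ j, j ≠ k → x j = x 0
      · have hik : i.succ = k := by
          by_contra hik
          have := hg _ hik
          rw [hx.1, hx.2] at this
          exact one_ne_zero this
        have hxs : x = Pi.single i.succ 1 := by
          funext j
          by_cases hj : j = i.succ
          · subst hj; simp [hx.2]
          · rw [hg j (hik ▸ hj), hx.1, Pi.single_eq_of_ne hj]
        rw [if_pos hg, if_pos hxs, if_pos hik]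
        norm_num [Complex.normSq_apply]
      · rw [if_neg hg, map_zero]
        split_ifs <;> norm_num
    · rw [if_neg hx]
      split_ifs <;> norm_num
  exact (Finset.sum_le_sum fun x _ => h x).trans (by simp)

/-- As k ≠ l, each Bob is decoupled in at most one of the two components. Hence p(0,1) ≤ 1/2 · 1/4 =
1/8, an error rate of at most 1/4, strictly below 1/2. -/
theorem condEntropyBob_ghzMixture_lt_one {k l : Fin (n + 1)} (hk : k ≠ 0) (hl : l ≠ 0)
    (hkl : k ≠ l) (i : Fin n) : condEntropyBob (nBB84 n) (ghzMixture k l) i < 1 := by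
  let p : Fin 2 × Fin 2 → ℝ := keyDist (nBB84 n) (ghzMixture k l) i
  have hp : ∀ a b, p (a, b) = ∑ x : Bits n, if x 0 = a ∧ x i.succ = b then
      (ghzMixture k l x x).re else 0 := keyDist_nBB84 _ i
  have hflip : ∀ a b, p (a + 1, b + 1) = p (a, b) := by
    intro a b
    rw [hp, hp, ← (flipBits n).sum_comp]
    refine Finset.sum_congr rfl fun x _ => ?_
    simp only [flipBits_apply, ghzMixture_flipBits_left, ghzMixture_flipBits_right, add_left_inj]
  have htr : p (0, 0) + p (0, 1) + (p (1, 0) + p (1, 1)) = 1 := by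
    have h1 := congrArg Complex.re (isState_ghzMixture hk hl).2
    rw [Matrix.trace, Complex.re_sum, Complex.one_re] at h1
    rw [← h1]
    simp only [hp, ← Finset.sum_add_distrib]
    refine Finset.sum_congr rfl fun x _ => ?_
    have h2 : ∀ a : Fin 2, a = 0 ∨ a = 1 := by decide
    rcases h2 (x 0) with h3 | h3 <;> rcases h2 (x i.succ) with h4 | h4 <;> simp [h3, h4]
  have h11 : p (1, 1) = p (0, 0) := hflip 0 0
  have h10 : p (1, 0) = p (0, 1) := hflip 0 1
  have hle : p (0, 1) ≤ 1 / 8 := by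
    have h1 : p (0, 1) =
        1 / 2 * (∑ x : Bits n,
          (if x 0 = 0 ∧ x i.succ = 1 then Complex.normSq (ghzPlus k x) else 0)) +
        1 / 2 * (∑ x : Bits n,
          (if x 0 = 0 ∧ x i.succ = 1 then Complex.normSq (ghzPlus l x) else 0)) := by
      rw [hp, Finset.mul_sum, Finset.mul_sum, ← Finset.sum_add_distrib]
      refine Finset.sum_congr rfl fun x _ => ?_
      rw [re_ghzMixture_diag]
      split_ifs <;> simp
    have h2 := sum_normSq_ghzPlus_le k i
    have h3 := sum_normSq_ghzPlus_le l i
    by_cases hik : i.succ = k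
    · rw [if_pos hik] at h2
      rw [if_neg fun h => hkl (hik.symm.trans h)] at h3
      linarith
    · rw [if_neg hik] at h2
      split_ifs at h3 <;> linarith
  exact binary_condEntropy_lt_one (p := p) h11 h10 (by linarith) (by intro h; linarith)

/-- All states with the statistics of `ghzMixture k l` have a positive key rate. -/
theorem keyRate_pos_of_statistics_eq {k l : Fin (n + 1)} (hk : k ≠ 0) (hl : l ≠ 0) (hkl : k ≠ l)
    {ρ : Op (fun _ : Fin (n + 1) => 2)} (hρ : IsState ρ)
    (h : statistics (nBB84 n) ρ = statistics (nBB84 n) (ghzMixture k l)) {m : ℕ}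
    {ψ : Matrix (Bits n) (Fin m) ℂ} (hψ : IsPurification ψ ρ) : 0 < keyRate (nBB84 n) ψ := by
  have hψ' : ψ * ψᴴ = ρ := hψ
  have hE : condEntropyEve (nBB84 n) ψ = 1 := by
    refine condEntropyEve_nBB84_eq_one ?_ ?_
    · rw [hψ', hρ.2, Complex.one_re]
    · rw [hψ', re_trace_flipOp_mul_eq_of_statistics_eq h, flipOp_mul_ghzMixture,
        (isState_ghzMixture hk hl).2, Complex.one_re]
  have hB : condEntropyBob (nBB84 n) ρ = condEntropyBob (nBB84 n) (ghzMixture k l) := by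
    funext i
    rw [condEntropyBob, condEntropyBob, keyDist_eq_of_statistics_eq h]
  obtain ⟨i, -⟩ := Fin.exists_succ_eq.2 hk
  -- With at least one Bob, the finite supremum is attained and inherits the strict bound.
  have : Nonempty (Fin n) := ⟨i⟩
  obtain ⟨j, hj⟩ := exists_eq_ciSup_of_finite (f := condEntropyBob (nBB84 n) (ghzMixture k l))
  rw [keyRate, hE, show reduced ψ = ρ from hψ, hB]
  refine lt_max_of_lt_right (sub_pos.2 ?_)
  change (⨆ i, condEntropyBob (nBB84 n) (ghzMixture k l) i) < 1
  rw [← hj]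
  exact condEntropyBob_ghzMixture_lt_one hk hl hkl j

theorem exists_biseparable_keyRate_pos (hn : 2 ≤ n) :
    ∃ ρ : Op (fun _ : Fin (n + 1) => 2), IsBiseparable ρ ∧ IsState ρ ∧
      ∀ ρ', IsState ρ' → statistics (nBB84 n) ρ' = statistics (nBB84 n) ρ →
        ∀ (m : ℕ) (ψ : Matrix (Bits n) (Fin m) ℂ), IsPurification ψ ρ' →
          0 < keyRate (nBB84 n) ψ := by
  let k : Fin (n + 1) := ⟨1, by omega⟩
  let l : Fin (n + 1) := ⟨2, by omega⟩
  have hk : k ≠ 0 := fun h => by simpa [k] using congrArg Fin.val h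
  have hl : l ≠ 0 := fun h => by simpa [l] using congrArg Fin.val h
  have hkl : k ≠ l := by simp [k, l]
  exact ⟨ghzMixture k l, isBiseparable_half_add_half (ketBra_ghzPlus_mem_partitionSeparable hk)
    (ketBra_ghzPlus_mem_partitionSeparable hl), isState_ghzMixture hk hl,
    fun ρ' hρ' h m ψ hψ => keyRate_pos_of_statistics_eq hk hl hkl hρ' h hψ⟩

end Witness

end CKA

end

theorem mainTheorem4 :
    -- a positive key rate of any protocol detects entanglement across every bipartition
    (∀ (n : ℕ), 1 ≤ n → ∀ (d : Fin (n + 1) → ℕ) (P : CKA.Protocol d) (ρ : CKA.Op d),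
      CKA.IsState ρ → ∀ (m : ℕ) (ψ : Matrix (CKA.Config d) (Fin m) ℂ),
      CKA.IsPurification ψ ρ → 0 < CKA.keyRate P ψ →
      ∀ S : Finset (Fin (n + 1)), S.Nonempty → S ≠ Finset.univ → ¬ CKA.SeparableAcross S ρ) ∧
    -- no linear witness for the union of the partition-separable sets detects a biseparable state
    (∀ (n : ℕ), 1 ≤ n → ∀ (d : Fin (n + 1) → ℕ) (W : CKA.Op d), W.IsHermitian →
      (∀ σ ∈ CKA.partitionSeparable d, 0 ≤ (W * σ).trace.re) →
      ∀ ρ : CKA.Op d, CKA.IsBiseparable ρ → 0 ≤ (W * ρ).trace.re) ∧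
    -- the union of the partition-separable sets is not convex
    (∀ (n : ℕ), 2 ≤ n → ∀ d : Fin (n + 1) → ℕ, (∀ i, 2 ≤ d i) →
      ¬ Convex ℝ (CKA.partitionSeparable d)) ∧
    -- a positive key rate detects biseparable states, already through the measured statistics
    (∀ (n : ℕ), 2 ≤ n → ∃ ρ : CKA.Op (fun _ : Fin (n + 1) => 2),
      CKA.IsBiseparable ρ ∧ ρ ∉ CKA.partitionSeparable _ ∧
      (∀ (m : ℕ) (ψ : Matrix (CKA.Config (fun _ : Fin (n + 1) => 2)) (Fin m) ℂ),
        CKA.IsPurification ψ ρ → 0 < CKA.keyRate (CKA.nBB84 n) ψ) ∧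
      (∀ ρ' : CKA.Op (fun _ : Fin (n + 1) => 2), CKA.IsState ρ' →
        CKA.statistics (CKA.nBB84 n) ρ' = CKA.statistics (CKA.nBB84 n) ρ →
        ∀ (m : ℕ) (ψ : Matrix (CKA.Config (fun _ : Fin (n + 1) => 2)) (Fin m) ℂ),
          CKA.IsPurification ψ ρ' → 0 < CKA.keyRate (CKA.nBB84 n) ψ)) ∧
    -- the condition that the key rate is positive is not a linear witness
    (∀ (n : ℕ), 2 ≤ n → ¬ ∃ W : CKA.Op (fun _ : Fin (n + 1) => 2), W.IsHermitian ∧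
      ∀ ρ : CKA.Op (fun _ : Fin (n + 1) => 2), CKA.IsState ρ →
        ∀ (m : ℕ) (ψ : Matrix (CKA.Config (fun _ : Fin (n + 1) => 2)) (Fin m) ℂ),
          CKA.IsPurification ψ ρ →
          (0 < CKA.keyRate (CKA.nBB84 n) ψ ↔ (W * ρ).trace.re < 0)) := by
  have part1 : ∀ (n : ℕ) (d : Fin (n + 1) → ℕ) (P : CKA.Protocol d) (ρ : CKA.Op d) (m : ℕ)
      (ψ : Matrix (CKA.Config d) (Fin m) ℂ), CKA.IsPurification ψ ρ → 0 < CKA.keyRate P ψ →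
      ρ ∉ CKA.partitionSeparable d := by
    rintro n d P ρ m ψ hψ hpos ⟨S, hS, hS', hsep⟩
    exact hpos.ne' (CKA.keyRate_eq_zero_of_separableAcross P hS hS' hsep hψ)
  refine ⟨fun n _ d P ρ _ m ψ hψ hpos S hS hS' hsep =>
      part1 n d P ρ m ψ hψ hpos ⟨S, hS, hS', hsep⟩,
    fun n _ d W _ hW ρ hρ => CKA.re_trace_mul_nonneg_of_isBiseparable hW hρ,
    fun n hn d hd => CKA.not_convex_partitionSeparable hn hd, fun n hn => ?_, fun n hn => ?_⟩
  · obtain ⟨ρ, hbi, hρ, h⟩ := CKA.exists_biseparable_keyRate_pos hn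
    obtain ⟨m, ψ, hψ⟩ := CKA.exists_isPurification hρ.1
    -- Non-membership in Σ is not computed from the state: it follows from its positive key rate.
    exact ⟨ρ, hbi, part1 _ _ _ ρ m ψ hψ (h ρ hρ rfl m ψ hψ), h ρ hρ rfl, h⟩
  · rintro ⟨W, -, hW⟩
    obtain ⟨ρ, hbi, hρ, h⟩ := CKA.exists_biseparable_keyRate_pos hn
    obtain ⟨m, ψ, hψ⟩ := CKA.exists_isPurification hρ.1
    -- If W were negative on some σ ∈ Σ, then σ would have a positive rate. So W is nonnegative on
    -- Σ, hence on the biseparable ρ, although ρ has a positive rate.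
    refine absurd ((hW ρ hρ m ψ hψ).1 (h ρ hρ rfl m ψ hψ))
      (not_lt.2 (CKA.re_trace_mul_nonneg_of_isBiseparable (fun σ hσ => not_lt.1 fun hneg => ?_) hbi))
    have hσ' := CKA.isState_of_mem_partitionSeparable hσ
    obtain ⟨m', ψ', hψ'⟩ := CKA.exists_isPurification hσ'.1
    exact part1 _ _ _ σ m' ψ' hψ' ((hW σ hσ' m' ψ' hψ').2 hneg) hσ
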